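/- Let $A$ be a commutative Noetherian ring, let $\underline a = a_1,\ldots,a_t$ be a finite sequence of elements of $A$, let $\mathfrak q = (a_1,\ldots,a_t)A$, and let $M$ be a finitely generated $A$-module. For $J = \{j_1 < \cdots < j_i\} \subseteq \{1,\ldots,t\}$ put $a_J = a_{j_1}\cdots a_{j_i}$ (so $a_\emptyset = 1$). The Čech complex $\check C^\bullet_{\underline a}(M)$ has the terms $\check C^i_{\underline a}(M) = \bigoplus_{|J| = i} M_{a_J}$, and the component of its differential from $M_{a_{J\setminus\{j_k\}}}$ to $M_{a_J}$, where $J = \{j_1<\cdots<j_{i+1}\}$, is $(-1)^{k+1}$ times the natural map (all other components are zero). For $n \in \mathbb N$ let $\check C^\bullet(\underline a,\underline a,M;n)$ be the subcomplex with the terms $$\check C^i(\underline a,\underline a,M;n) = \bigoplus_{|J| = i} \mathfrak q^n M[\mathfrak q^{i}/a_J] \subseteq \bigoplus_{|J| = i} M_{a_J},$$ where $M[\mathfrak q^{i}/a_J] \subseteq M_{a_J}$ is the submodule of all elements of the form $m_0/1 + q_1m_1/a_J + \cdots + q_sm_s/a_J^s$ with $s \ge 0$, $m_k \in M$ and $q_k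 \in \mathfrak q^{ik}$. Let $\check L^i(\underline a,\underline a,M;n)$ be the $i$-th cohomology module of the factor complex $\check C^\bullet_{\underline a}(M)/\check C^\bullet(\underline a,\underline a,M;n)$. Let $H^i_{\underline a}(M)$ be the $i$-th local cohomology module of $M$ with respect to $\mathfrak q$, that is, the value at $M$ of the $i$-th right derived functor of $\Gamma_{\mathfrak q}(M) = \{m \in M \mid \operatorname{Supp}_A(Am) \subseteq V(\mathfrak q)\}$. Then there is an integer $N$ such that for all $n \ge N$ and all $i \ge 0$ there is an isomorphism of $A$-modules $$H^i_{\underline a}(M) \cong \check L^i(\underline a,\underline a,M;n).$$ -/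

import Mathlib

open CategoryTheory

universe u

noncomputable section

namespace ModCech

/-! ### Local cohomology as the right derived functors of the section functor -/

section LocalCohomology

variable {A : Type u} [CommRing A]

lemma support_span_le_iff (q : Ideal A) {M : Type u} [AddCommGroup M] [Module A M] (m : M) :
    Module.support A (Submodule.span A {m}) ⊆ PrimeSpectrum.zeroLocus (q : Set A) ↔
      ∀ p : PrimeSpectrum A,
        (∀ r : A, r • m = 0 → r ∈ p.asIdeal) → q ≤ p.asIdeal := by
  rw [Module.support_eq_zeroLocus]
  have key : ∀ p : PrimeSpectrum A,
      p ∈ PrimeSpectrum.zeroLocus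
        (Module.annihilator A (Submodule.span A {m}) : Set A) ↔
        ∀ r : A, r • m = 0 → r ∈ p.asIdeal := by
    intro p
    rw [PrimeSpectrum.mem_zeroLocus]
    constructor
    · intro h r hr
      exact h ((Submodule.mem_annihilator_span_singleton m r).2 hr)
    · intro h r hr
      exact h r ((Submodule.mem_annihilator_span_singleton m r).1 hr)
  constructor
  · intro h p hp
    exact h ((key p).2 hp)
  · intro h p hp
    exact h p ((key p).1 hp)

/-- The submodule `Γ_q(M) = {m ∈ M | Supp_A (A m) ⊆ V(q)}`. -/
def sections (q : Ideal A) (M : Type u) [AddCommGroup M] [Module A M] : Submodule A M where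
  carrier := {m | Module.support A (Submodule.span A {m}) ⊆
    PrimeSpectrum.zeroLocus (q : Set A)}
  zero_mem' := by
    rw [Set.mem_ofPred_eq, support_span_le_iff]
    intro p hp
    exact absurd ((Ideal.eq_top_iff_one _).2 (hp 1 (by simp))) p.isPrime.ne_top
  add_mem' := by
    intro x y hx hy
    rw [Set.mem_ofPred_eq, support_span_le_iff] at hx hy ⊢
    intro p hp
    by_cases h : ∀ r : A, r • x = 0 → r ∈ p.asIdeal
    · exact hx p h
    · push Not at h
      obtain ⟨r, hr, hrp⟩ := h
      refine hy p fun s hs => ?_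
      have : r * s ∈ p.asIdeal := hp _ (by
        rw [smul_add, mul_smul, mul_smul, hs, smul_comm, hr]; simp)
      exact (p.isPrime.mem_or_mem this).resolve_left hrp
  smul_mem' := by
    intro c x hx
    rw [Set.mem_ofPred_eq, support_span_le_iff] at hx ⊢
    intro p hp
    exact hx p fun r hr => hp r (by rw [smul_comm, hr, smul_zero])

lemma sections_le_comap (q : Ideal A) {M N : Type u} [AddCommGroup M] [Module A M]
    [AddCommGroup N] [Module A N] (f : M →ₗ[A] N) :
    sections q M ≤ (sections q N).comap f := by
  intro x hx
  have hx' := (support_span_le_iff q x).1 hx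
  refine (support_span_le_iff q (f x)).2 fun p hp => hx' p fun r hr => hp r ?_
  rw [← map_smul, hr, map_zero]

/-- The section functor `Γ_q` on `A`-modules. -/
def sectionFunctor (q : Ideal A) : ModuleCat.{u} A ⥤ ModuleCat.{u} A where
  obj M := ModuleCat.of A (sections q M)
  map f := ModuleCat.ofHom (f.hom.restrict (sections_le_comap q f.hom))

instance (q : Ideal A) : (sectionFunctor q).Additive where
  map_add := rfl

/-- The local cohomology module `H^i_q(M)`, the value at `M` of the `i`-th right derived functor
of `Γ_q`. -/
def H (q : Ideal A) (M : Type u) [AddCommGroup M] [Module A M] (i : ℕ) : ModuleCat.{u} A :=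
  ((sectionFunctor q).rightDerived i).obj (ModuleCat.of A M)

end LocalCohomology

/-! ### The Čech complex -/

section Cech

variable {A : Type u} [CommRing A]

/-- The localization `M_f` of `M` at the powers of `f`. -/
abbrev Away (f : A) (M : Type u) [AddCommGroup M] [Module A M] : Type u :=
  LocalizedModule (Submonoid.powers f) M

lemma isUnit_algebraMap_end {f g : A} (h : f ∣ g) (M : Type u) [AddCommGroup M] [Module A M]
    (x : Submonoid.powers f) :
    IsUnit (algebraMap A (Module.End A (Away g M)) x) := by
  obtain ⟨_, k, rfl⟩ := x
  have hg : IsUnit (algebraMap A (Module.End A (Away g M)) g) :=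
    IsLocalizedModule.map_units (LocalizedModule.mkLinearMap (Submonoid.powers g) M)
      ⟨g, Submonoid.mem_powers g⟩
  obtain ⟨b, rfl⟩ := h
  rw [map_mul, Commute.isUnit_mul_iff (Algebra.commutes _ _)] at hg
  simpa only [map_pow] using hg.1.pow k

/-- The fraction `m / f ^ k` in `M_f`. -/
def frac (f : A) {M : Type u} [AddCommGroup M] [Module A M] (m : M) (k : ℕ) : Away f M :=
  LocalizedModule.mk m ⟨f ^ k, k, rfl⟩

/-- For `f ∣ g`, the natural map `M_f → M_g`, `m / f ^ k ↦ (g / f) ^ k m / g ^ k`. -/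
def awayMap {f g : A} (h : f ∣ g) (M : Type u) [AddCommGroup M] [Module A M] :
    Away f M →ₗ[A] Away g M :=
  LocalizedModule.lift (Submonoid.powers f)
    (LocalizedModule.mkLinearMap (Submonoid.powers g) M) (isUnit_algebraMap_end h M)

lemma awayMap_frac (f b : A) (M : Type u) [AddCommGroup M] [Module A M] {g : A} (hg : g = f * b)
    (h : f ∣ g) (m : M) (k : ℕ) :
    awayMap h M (frac f m k) = frac g (b ^ k • m) k := by
  subst hg
  unfold awayMap frac
  rw [LocalizedModule.lift_mk, Module.End.algebraMap_isUnit_inv_apply_eq_iff,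
    LocalizedModule.smul'_mk, LocalizedModule.mkLinearMap_apply]
  change _ = LocalizedModule.mk (f ^ k • b ^ k • m) _
  rw [smul_smul, ← mul_pow]
  exact (LocalizedModule.mk_cancel
    (⟨(f * b) ^ k, k, rfl⟩ : Submonoid.powers (f * b)) m).symm

lemma awayMap_awayMap {f g e : A} (h : f ∣ g) (h' : g ∣ e) (M : Type u) [AddCommGroup M]
    [Module A M] (x : Away f M) :
    awayMap h' M (awayMap h M x) = awayMap (h.trans h') M x := by
  obtain ⟨b, rfl⟩ := h
  obtain ⟨b', rfl⟩ := h'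
  induction x using LocalizedModule.induction_on with
  | h m s =>
    obtain ⟨_, k, rfl⟩ := s
    change awayMap _ M (awayMap _ M (frac f m k)) = awayMap _ M (frac f m k)
    rw [awayMap_frac f b M rfl, awayMap_frac (f * b) b' M rfl,
      awayMap_frac f (b * b') M (mul_assoc _ _ _), smul_smul, ← mul_pow, mul_comm b']

variable {t : ℕ} (a : Fin t → A)

/-- The product `a_{j_1} ⋯ a_{j_i}` for `J = {j_1 < ⋯ < j_i}`. -/
abbrev prodOn (J : Finset (Fin t)) : A := ∏ j ∈ J, a j

/-- The subsets `{j_1 < ⋯ < j_i}` of the index set with `i` elements. -/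
abbrev Idx (t i : ℕ) : Type := {J : Finset (Fin t) // J.card = i}

/-- `J` without its element `j`. -/
def Idx.erase {t i : ℕ} (J : Idx t (i + 1)) (j : J.1) : Idx t i :=
  ⟨J.1.erase j, by rw [Finset.card_erase_of_mem j.2, J.2]; rfl⟩

lemma prodOn_eq {i : ℕ} (J : Idx t (i + 1)) (j : J.1) :
    prodOn a J.1 = prodOn a (J.erase j).1 * a j :=
  (Finset.prod_erase_mul _ _ j.2).symm

lemma prodOn_dvd {i : ℕ} (J : Idx t (i + 1)) (j : J.1) :
    prodOn a (J.erase j).1 ∣ prodOn a J.1 :=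
  ⟨a j, prodOn_eq a J j⟩

/-- The number of elements of `J` that are smaller than `j`: if `j = j_k` in
`J = {j_1 < ⋯ < j_i}`, then this is `k - 1`. -/
def pos (J : Finset (Fin t)) (j : Fin t) : ℕ := (J.filter (· < j)).card

variable (M : Type u) [AddCommGroup M] [Module A M]

/-- The `i`-th term of the Čech complex of `M`: the direct sum of the modules
`M_{a_{j_1} ⋯ a_{j_i}}` over all `j_1 < ⋯ < j_i`. -/
abbrev CechX (i : ℕ) : Type u := ∀ J : Idx t i, Away (prodOn a J.1) M

/-- The Čech differential: the component from `J ∖ {j_k}` to `J = {j_1 < ⋯ < j_{i+1}}` is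
`(-1) ^ (k + 1)` times the natural map; the other components are zero. -/
def cechD (i : ℕ) : CechX a M i →ₗ[A] CechX a M (i + 1) :=
  LinearMap.pi fun J => ∑ j : J.1,
    (-1 : A) ^ pos J.1 j • (awayMap (prodOn_dvd a J j) M ∘ₗ LinearMap.proj (J.erase j))

lemma cechD_apply (i : ℕ) (x : CechX a M i) (J : Idx t (i + 1)) :
    cechD a M i x J = ∑ j : J.1, (-1 : A) ^ pos J.1 j •
      awayMap (prodOn_dvd a J j) M (x (J.erase j)) := by
  simp [cechD]

lemma pos_erase {J : Finset (Fin t)} {j l : Fin t} (hj : j ∈ J) (h : j < l) :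
    pos J j + pos (J.erase j) l + 1 = pos J l + pos (J.erase l) j := by
  have h1 : (J.erase l).filter (· < j) = J.filter (· < j) := by
    ext k
    simp only [Finset.mem_filter, Finset.mem_erase]
    exact ⟨fun hk => ⟨hk.1.2, hk.2⟩, fun hk => ⟨⟨(hk.2.trans h).ne, hk.1⟩, hk.2⟩⟩
  have h2 : (J.erase j).filter (· < l) = (J.filter (· < l)).erase j := by
    ext k
    simp only [Finset.mem_filter, Finset.mem_erase]
    tauto
  have h3 : j ∈ J.filter (· < l) := Finset.mem_filter.2 ⟨hj, h⟩
  have h4 := Finset.card_erase_add_one h3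
  unfold pos
  rw [h1, h2]
  omega

lemma sign_swap {J : Finset (Fin t)} {j l : Fin t} (hj : j ∈ J) (hl : l ∈ J) (h : j ≠ l) :
    (-1 : A) ^ (pos J j + pos (J.erase j) l) + (-1) ^ (pos J l + pos (J.erase l) j) = 0 := by
  rcases lt_or_gt_of_ne h with h | h
  · rw [← pos_erase hj h, pow_succ]; ring
  · rw [← pos_erase hl h, pow_succ]; ring

lemma awayMap_congr {i : ℕ} (x : CechX a M i) {K K' : Idx t i} (hK : K = K') {g : A}
    (h : prodOn a K.1 ∣ g) (h' : prodOn a K'.1 ∣ g) :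
    awayMap h M (x K) = awayMap h' M (x K') := by
  subst hK; rfl

lemma cechD_cechD (i : ℕ) (x : CechX a M i) :
    cechD a M (i + 1) (cechD a M i x) = 0 := by
  funext J
  have key : ∀ (j : J.1) (l : (J.erase j).1),
      prodOn a ((J.erase j).erase l).1 ∣ prodOn a J.1 := fun j l =>
    (prodOn_dvd a (J.erase j) l).trans (prodOn_dvd a J j)
  have hJ : cechD a M (i + 1) (cechD a M i x) J =
      ∑ s : (Σ j : J.1, (J.erase j).1), (-1 : A) ^ (pos J.1 s.1 + pos (J.1.erase s.1) s.2) •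
        awayMap (key s.1 s.2) M (x ((J.erase s.1).erase s.2)) := by
    rw [cechD_apply, Fintype.sum_sigma]
    refine Finset.sum_congr rfl fun j _ => ?_
    rw [cechD_apply, map_sum, Finset.smul_sum]
    refine Finset.sum_congr rfl fun l _ => ?_
    rw [map_smul, awayMap_awayMap, smul_smul, ← pow_add]
    rfl
  rw [hJ, Pi.zero_apply]
  have hmem : ∀ s : (Σ j : J.1, (J.erase j).1), s.2.1 ≠ s.1.1 ∧ s.2.1 ∈ J.1 := fun s =>
    Finset.mem_erase.1 s.2.2
  refine Finset.sum_involution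
    (fun s _ => ⟨⟨s.2.1, (hmem s).2⟩,
      ⟨s.1.1, Finset.mem_erase.2 ⟨(hmem s).1.symm, s.1.2⟩⟩⟩) ?_ ?_ ?_ ?_
  · intro s _
    have hs : (J.erase s.1).erase s.2 = Idx.erase (Idx.erase J ⟨s.2.1, (hmem s).2⟩)
        ⟨s.1.1, Finset.mem_erase.2 ⟨(hmem s).1.symm, s.1.2⟩⟩ :=
      Subtype.ext (Finset.erase_right_comm)
    rw [awayMap_congr a M x hs (key s.1 s.2) (key ⟨s.2.1, (hmem s).2⟩
      ⟨s.1.1, Finset.mem_erase.2 ⟨(hmem s).1.symm, s.1.2⟩⟩), ← add_smul,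
      sign_swap s.1.2 (hmem s).2 (hmem s).1.symm, zero_smul]
  · intro s _ _ h
    have := congrArg (fun s => s.1.1) h
    exact (hmem s).1 this
  · intro s _
    exact Finset.mem_univ _
  · intro s _
    rfl

/-! ### The modified Čech complexes -/

/-- `M[q^c/f] ⊆ M_f`: the finite sums `m_0 / 1 + q_1 m_1 / f + ⋯ + q_s m_s / f ^ s` with
`m_k ∈ M` and `q_k ∈ q ^ (c k)`. -/
def fracSubmodule (q : Ideal A) (c : ℕ) (f : A) : Submodule A (Away f M) :=
  Submodule.span A {x | ∃ (k : ℕ) (r : A) (m : M), r ∈ q ^ (c * k) ∧ x = frac f (r • m) k}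

lemma fracSubmodule_le_comap (q : Ideal A) (c d : ℕ) {f b g : A} (hb : b ∈ q ^ d)
    (hg : g = f * b) (h : f ∣ g) :
    fracSubmodule M q c f ≤ (fracSubmodule M q (c + d) g).comap (awayMap h M) := by
  rw [fracSubmodule, Submodule.span_le]
  rintro _ ⟨k, r, m, hr, rfl⟩
  rw [SetLike.mem_coe, Submodule.mem_comap, awayMap_frac f b M hg, smul_smul]
  refine Submodule.subset_span ⟨k, b ^ k * r, m, ?_, rfl⟩
  rw [add_mul, pow_add, mul_comm (b ^ k)]
  refine Ideal.mul_mem_mul hr ?_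
  rw [pow_mul]
  exact Ideal.pow_mem_pow hb k

variable (q : Ideal A) (c : Fin t → ℕ)

/-- The submodule `Č^i(a, q, M; n)` of the `i`-th term of the Čech complex: the direct sum of the
submodules `q^n M[q^(c_{j_1} + ⋯ + c_{j_i}) / (a_{j_1} ⋯ a_{j_i})]`. -/
def subCechX (n i : ℕ) : Submodule A (CechX a M i) :=
  Submodule.pi Set.univ fun J => q ^ n • fracSubmodule M q (∑ j ∈ J.1, c j) (prodOn a J.1)

lemma subCechX_le_comap (ha : ∀ j, a j ∈ q ^ c j) (n i : ℕ) :
    subCechX a M q c n i ≤ (subCechX a M q c n (i + 1)).comap (cechD a M i) := by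
  intro x hx
  rw [Submodule.mem_comap, subCechX, Submodule.mem_pi]
  intro J _
  rw [cechD_apply]
  refine Submodule.sum_mem _ fun j _ => Submodule.smul_mem _ _ ?_
  have hxj : x (J.erase j) ∈ q ^ n • fracSubmodule M q (∑ l ∈ (J.erase j).1, c l)
      (prodOn a (J.erase j).1) := Submodule.mem_pi.1 hx (J.erase j) (Set.mem_univ _)
  have hle := fracSubmodule_le_comap M q (∑ l ∈ (J.erase j).1, c l) (c j) (ha j)
    (prodOn_eq a J j) (prodOn_dvd a J j)
  have hc : (∑ l ∈ (J.erase j).1, c l) + c j = ∑ l ∈ J.1, c l :=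
    Finset.sum_erase_add _ _ j.2
  rw [hc] at hle
  have := Submodule.mem_map_of_mem (f := awayMap (prodOn_dvd a J j) M) hxj
  rw [Submodule.map_smul''] at this
  exact Submodule.smul_mono le_rfl (Submodule.map_le_iff_le_comap.2 hle) this

/-- The factor complex `Ľ^•(a, q, M; n)` of the Čech complex of `M` by the subcomplex
`Č^•(a, q, M; n)`. -/
def factorComplex (ha : ∀ j, a j ∈ q ^ c j) (n : ℕ) : CochainComplex (ModuleCat.{u} A) ℕ :=
  CochainComplex.of (fun i => ModuleCat.of A (CechX a M i ⧸ subCechX a M q c n i))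
    (fun i => ModuleCat.ofHom (Submodule.mapQ _ _ (cechD a M i) (subCechX_le_comap a M q c ha n i)))
    (fun i => by
      ext1
      refine Submodule.linearMap_qext _ (LinearMap.ext fun x => ?_)
      change Submodule.Quotient.mk (cechD a M (i + 1) (cechD a M i x)) = 0
      rw [cechD_cechD, Submodule.Quotient.mk_zero])

/-- The cohomology module `Ľ^i(a, q, M; n)` of the factor complex. -/
def L (ha : ∀ j, a j ∈ q ^ c j) (n i : ℕ) : ModuleCat.{u} A :=
  (factorComplex a M q c ha n).homology i

lemma mem_span_range_pow_one (a : Fin t → A) (j : Fin t) :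
    a j ∈ Ideal.span (Set.range a) ^ (1 : ℕ) := by
  rw [pow_one]
  exact Ideal.subset_span ⟨j, rfl⟩

end Cech

end ModCech

end

/-!
The degree `i` term of `Č(a, a, M; n)` is the degree `n` part of the Čech complex of the Rees module
`⨁ q ^ n M` on the elements `a_1 T, …, a_t T`. Two facts give the theorem: this subcomplex is exact
for `n ≫ 0` (`exists_subCechX_exact`), so that the factor complex has the Čech cohomology of `M`
(`nonempty_L_iso_cech`); and Čech cohomology over a Noetherian ring is local cohomology
(`nonempty_localCohomology_iso_cech`).

Both rest on one uniform vanishing result, `exists_koszulExact`: there is `N` such that for `n ≥ N`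
and all exponents `k_j ≥ 1` the degree `n` part of the Koszul complex of the Rees module on the
elements `(a_j T) ^ (k_j)` is exact. For exponents `1` this is the Artin–Rees lemma, applied to the
module of cocycles, together with the fact that multiplication by `a_j` is null-homotopic
(`exists_koszulExact_one`). Exponents are then raised one at a time by `KoszulExact.update_succ`, with
no loss in `N`: if multiplication by `x` from a graded complex `C` to its shift `C(1)` is a
quasi-isomorphism in all degrees `≥ n`, then so is `x ^ k : C → C(k)`.

A Čech cocycle is represented by a Koszul cocycle for large equal exponents
(`exists_koszul_cocycle`), which gives the exactness of the subcomplex at once. For an injective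
module `I`, a Koszul cocycle is a linear form on homological Koszul chains of `A`; the vanishing
result for `M = A`, with the signs of the homological complex, shows that the transition map to a
smaller exponent carries cycles of positive degree to boundaries. Hence the linear form extends, and
the Čech complex of `I` is exact in positive degrees (`cech_exact_of_injective`). Since the Čech
complex is an exact functor and computes the sections with support in degree zero, dimension
shifting along an injective resolution identifies its cohomology with local cohomology
(`nonempty_cech_equiv_sections`).
-/

noncomputable section

namespace ModCech

/-! ### Koszul complexes with signs -/

section Koszul

variable {A : Type*} [CommRing A] {ι : Type*} {M : Type*} [AddCommGroup M] [Module A M]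

variable (M) in
/-- The degree `n` part of the Koszul complex of the Rees module of `M` on the elements
`(a_j T) ^ (k j)`: its coefficient at `J` runs through `q ^ (n + ∑_{j ∈ J} k j) M`. -/
def koszulFil (q : Ideal A) (n : ℕ) (k : ι → ℕ) : Submodule A (Finset ι → M) :=
  Submodule.pi Set.univ fun J => q ^ (n + ∑ j ∈ J, k j) • (⊤ : Submodule A M)

lemma mem_koszulFil {q : Ideal A} {n : ℕ} {k : ι → ℕ} {z : Finset ι → M} :
    z ∈ koszulFil M q n k ↔ ∀ J, z J ∈ q ^ (n + ∑ j ∈ J, k j) • (⊤ : Submodule A M) := by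
  simp [koszulFil, Submodule.mem_pi]

lemma smul_mem_pow_add {q : Ideal A} {m l N : ℕ} {r : A} {x : M} (hr : r ∈ q ^ m)
    (hx : x ∈ q ^ l • (⊤ : Submodule A M)) (h : N = m + l) :
    r • x ∈ q ^ N • (⊤ : Submodule A M) := by
  rw [h, pow_add, mul_smul]
  exact Submodule.smul_mem_smul hr hx

variable (M) in
/-- The degree filtration of the Koszul complex of the Rees module on the elements `a_j T`. -/
def koszulFiltration (ι : Type*) (q : Ideal A) : q.Filtration (Finset ι → M) where
  N n := koszulFil M q n fun _ => 1
  mono n z hz := by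
    rw [mem_koszulFil] at hz ⊢
    exact fun J => Submodule.smul_mono_left (Ideal.pow_le_pow_right (by omega)) (hz J)
  smul_le n := by
    refine Submodule.smul_le.2 fun r hr z hz => ?_
    rw [mem_koszulFil] at hz ⊢
    exact fun J => smul_mem_pow_add (m := 1) (by simpa using hr) (hz J) (by ring)

variable [DecidableEq ι]

lemma pow_update (a : ι → A) (k : ι → ℕ) (j : ι) (m : ℕ) :
    (fun i => a i ^ Function.update k j m i) =
      Function.update (fun i => a i ^ k i) j (a j ^ m) := by
  funext i
  by_cases h : i = j
  · subst h; simp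
  · simp [h]

lemma sum_update_eq_add_erase (k : ι → ℕ) {j : ι} {J : Finset ι} (h : j ∈ J) (m : ℕ) :
    ∑ i ∈ J, Function.update k j m i = m + ∑ i ∈ J.erase j, k i := by
  rw [Finset.sum_update_of_mem h, Finset.sdiff_singleton_eq_erase]

/-- A choice of signs `sgn J j` (for `j ∈ J`) that makes the maps `J ∖ {j} → J` anticommute. -/
structure KoszulSigns (A : Type*) [CommRing A] (ι : Type*) [DecidableEq ι] where
  /-- The sign of the component from `J ∖ {j}` to `J`. -/
  sgn : Finset ι → ι → A
  mul_self : ∀ J j, sgn J j * sgn J j = 1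
  swap : ∀ {J : Finset ι} {j l : ι}, j ∈ J → l ∈ J → j ≠ l →
    sgn J j * sgn (J.erase j) l + sgn J l * sgn (J.erase l) j = 0

variable (s : KoszulSigns A ι)

/-- Exterior multiplication by the `j`-th basis vector, where a function on the finite subsets of
`ι` stands for the family of its coefficients. -/
def wedge (j : ι) : (Finset ι → M) →ₗ[A] (Finset ι → M) :=
  LinearMap.pi fun J => if j ∈ J then s.sgn J j • LinearMap.proj (J.erase j) else 0

/-- Contraction with the `j`-th coordinate form. -/
def contr (j : ι) : (Finset ι → M) →ₗ[A] (Finset ι → M) :=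
  LinearMap.pi fun J => if j ∈ J then 0 else s.sgn (insert j J) j • LinearMap.proj (insert j J)

lemma wedge_apply (j : ι) (z : Finset ι → M) (J : Finset ι) :
    wedge s j z J = if j ∈ J then s.sgn J j • z (J.erase j) else 0 := by
  unfold wedge
  rw [LinearMap.pi_apply]
  split_ifs <;> simp

lemma contr_apply (j : ι) (z : Finset ι → M) (J : Finset ι) :
    contr s j z J = if j ∈ J then 0 else s.sgn (insert j J) j • z (insert j J) := by
  unfold contr
  rw [LinearMap.pi_apply]
  split_ifs <;> simp

lemma wedge_contr_apply (j : ι) (z : Finset ι → M) (J : Finset ι) :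
    wedge s j (contr s j z) J = if j ∈ J then z J else 0 := by
  rw [wedge_apply]
  split_ifs with h
  · rw [contr_apply, if_neg (Finset.notMem_erase j J), Finset.insert_erase h, smul_smul,
      s.mul_self, one_smul]
  · rfl

lemma contr_wedge_apply (j : ι) (z : Finset ι → M) (J : Finset ι) :
    contr s j (wedge s j z) J = if j ∈ J then 0 else z J := by
  rw [contr_apply]
  split_ifs with h
  · rfl
  · rw [wedge_apply, if_pos (Finset.mem_insert_self j J), Finset.erase_insert h, smul_smul,
      s.mul_self, one_smul]

lemma contr_wedge (j : ι) (z : Finset ι → M) :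
    contr s j (wedge s j z) = z - wedge s j (contr s j z) := by
  funext J
  rw [Pi.sub_apply, wedge_contr_apply, contr_wedge_apply]
  split_ifs <;> simp

lemma wedge_wedge_self (j : ι) (z : Finset ι → M) : wedge s j (wedge s j z) = 0 := by
  funext J
  rw [wedge_apply, wedge_apply, if_neg (Finset.notMem_erase j J)]
  simp

lemma contr_contr_self (j : ι) (z : Finset ι → M) : contr s j (contr s j z) = 0 := by
  funext J
  rw [contr_apply, contr_apply, if_pos (Finset.mem_insert_self j J)]
  simp

lemma wedge_wedge (j l : ι) (z : Finset ι → M) :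
    wedge s j (wedge s l z) = - wedge s l (wedge s j z) := by
  by_cases hjl : j = l
  · subst hjl
    rw [wedge_wedge_self, neg_zero]
  funext J
  rw [Pi.neg_apply, wedge_apply, wedge_apply, wedge_apply, wedge_apply]
  by_cases hj : j ∈ J <;> by_cases hl : l ∈ J
  · rw [if_pos hj, if_pos hl, if_pos (Finset.mem_erase.2 ⟨Ne.symm hjl, hl⟩),
      if_pos (Finset.mem_erase.2 ⟨hjl, hj⟩), smul_smul, smul_smul, Finset.erase_right_comm,
      eq_neg_iff_add_eq_zero, ← add_smul, s.swap hj hl hjl, zero_smul]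
  all_goals simp [hj, hl]

lemma contr_wedge_of_ne {j l : ι} (hjl : j ≠ l) (z : Finset ι → M) :
    contr s j (wedge s l z) = - wedge s l (contr s j z) := by
  funext J
  rw [Pi.neg_apply, contr_apply, wedge_apply, wedge_apply, contr_apply]
  by_cases hj : j ∈ J
  · simp [hj, hjl]
  by_cases hl : l ∈ J
  · have hj' : j ∉ J.erase l := fun h => hj (Finset.mem_of_mem_erase h)
    have hK : insert j (J.erase l) = (insert j J).erase l :=
      (Finset.erase_insert_of_ne hjl).symm
    rw [if_neg hj, if_pos (Finset.mem_insert_of_mem hl), if_pos hl, if_neg hj', hK, smul_smul,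
      smul_smul, eq_neg_iff_add_eq_zero, ← add_smul]
    have h := s.swap (Finset.mem_insert_self j J) (Finset.mem_insert_of_mem hl) hjl
    rw [Finset.erase_insert hj] at h
    have h1 := s.mul_self J l
    have h2 := s.mul_self (insert j J) l
    have : s.sgn (insert j J) j * s.sgn (insert j J) l +
        s.sgn J l * s.sgn ((insert j J).erase l) j = 0 := by
      linear_combination (s.sgn (insert j J) l * s.sgn J l) * h -
        (s.sgn (insert j J) j * s.sgn (insert j J) l) * h1 -
        (s.sgn J l * s.sgn ((insert j J).erase l) j) * h2
    rw [this, zero_smul]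
  · have hl' : l ∉ insert j J := fun h => (Finset.mem_insert.1 h).elim (Ne.symm hjl) hl
    simp [hj, hl, hl']

variable [Fintype ι]

/-- The Koszul differential `z ↦ (∑ c_j e_j) ∧ z`. -/
def koszulD (c : ι → A) : (Finset ι → M) →ₗ[A] (Finset ι → M) :=
  ∑ j, c j • wedge s j

lemma koszulD_eq_sum (c : ι → A) (z : Finset ι → M) :
    koszulD s c z = ∑ j, c j • wedge s j z := by
  simp [koszulD]

lemma koszulD_apply (c : ι → A) (z : Finset ι → M) (J : Finset ι) :
    koszulD s c z J = ∑ j : J, c j • s.sgn J j • z (J.erase j) := by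
  rw [koszulD_eq_sum, Finset.sum_apply]
  simp only [Pi.smul_apply, wedge_apply, smul_ite, smul_zero]
  rw [Finset.sum_ite, Finset.sum_const_zero, add_zero, Finset.filter_mem_eq_inter,
    Finset.univ_inter, ← Finset.sum_coe_sort]

lemma wedge_koszulD (c : ι → A) (j : ι) (z : Finset ι → M) :
    wedge s j (koszulD s c z) = - koszulD s c (wedge s j z) := by
  rw [koszulD_eq_sum, koszulD_eq_sum, map_sum, ← Finset.sum_neg_distrib]
  refine Finset.sum_congr rfl fun l _ => ?_
  rw [map_smul, wedge_wedge, smul_neg]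

/-- Contraction with the `j`-th coordinate form is a homotopy from multiplication by `c j` to zero.
-/
lemma contr_koszulD (c : ι → A) (j : ι) (z : Finset ι → M) :
    contr s j (koszulD s c z) = c j • z - koszulD s c (contr s j z) := by
  rw [koszulD_eq_sum, koszulD_eq_sum, map_sum, ← Finset.add_sum_erase _ _ (Finset.mem_univ j),
    ← Finset.add_sum_erase _ _ (Finset.mem_univ j), map_smul, contr_wedge, smul_sub,
    ← sub_sub, sub_eq_add_neg _ (Finset.sum _ _), ← Finset.sum_neg_distrib]
  refine congrArg₂ _ rfl (Finset.sum_congr rfl fun l hl => ?_)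
  rw [map_smul, contr_wedge_of_ne s (Finset.ne_of_mem_erase hl).symm, smul_neg]

lemma koszulD_update (c : ι → A) (j : ι) (x : A) (z : Finset ι → M) :
    koszulD s (Function.update c j x) z =
      koszulD s (Function.update c j 0) z + x • wedge s j z := by
  rw [koszulD_eq_sum, koszulD_eq_sum, ← Finset.add_sum_erase _ _ (Finset.mem_univ j),
    ← Finset.add_sum_erase (a := j) _ (fun i => Function.update c j 0 i • wedge s i z)
    (Finset.mem_univ j)]
  rw [Function.update_self, Function.update_self, zero_smul, zero_add, add_comm]
  refine congrArg₂ _ (Finset.sum_congr rfl fun l hl => ?_) rfl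
  rw [Function.update_of_ne (Finset.ne_of_mem_erase hl),
    Function.update_of_ne (Finset.ne_of_mem_erase hl)]

/-- Exactness of the Koszul complex of the Rees module on the elements `(a_j T) ^ (k j)` in
degree `n`. -/
def KoszulExact (M : Type*) [AddCommGroup M] [Module A M] (q : Ideal A) (a : ι → A) (n : ℕ)
    (k : ι → ℕ) : Prop :=
  ∀ z ∈ koszulFil M q n k, koszulD s (fun j => a j ^ k j) z = 0 →
    ∃ w ∈ koszulFil M q n k, koszulD s (fun j => a j ^ k j) w = z

/-- If the Koszul complexes for the exponents `m` and `1` of the `j`-th element are exact in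
degrees at least `n`, then so is the one for the exponent `m + 1`. -/
lemma KoszulExact.update_succ {q : Ideal A} {a : ι → A} {j : ι} (ha : a j ∈ q) {n : ℕ}
    {k : ι → ℕ} {m : ℕ} (h1 : KoszulExact s M q a (n + m) (Function.update k j 1))
    (hm : KoszulExact s M q a n (Function.update k j m)) :
    KoszulExact s M q a n (Function.update k j (m + 1)) := by
  unfold KoszulExact at h1 hm ⊢
  rw [pow_update, pow_one] at h1
  rw [pow_update] at hm ⊢
  simp only [koszulD_update s _ j (a j)] at h1
  simp only [koszulD_update s _ j (a j ^ m)] at hm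
  simp only [koszulD_update s _ j (a j ^ (m + 1))]
  set D : (Finset ι → M) →ₗ[A] (Finset ι → M) :=
    koszulD s (Function.update (fun i => a i ^ k i) j 0) with hD
  set W : (Finset ι → M) →ₗ[A] (Finset ι → M) := wedge s j with hW
  set C : (Finset ι → M) →ₗ[A] (Finset ι → M) := contr s j with hC
  have hCD (y) : C (D y) = - D (C y) := by
    rw [hC, hD, contr_koszulD, Function.update_self, zero_smul, zero_sub]
  have hWD (y) : W (D y) = - D (W y) := wedge_koszulD s _ j y
  have hCW (y) : C (W y) = y - W (C y) := contr_wedge s j y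
  have hWW (y) : W (W y) = 0 := wedge_wedge_self s j y
  have hCC (y) : C (C y) = 0 := contr_contr_self s j y
  have hWCW (y) : W (C (W y)) = W y := by rw [hCW, map_sub, hWW, sub_zero]
  have hCWC (y) : C (W (C y)) = C y := by rw [hCW, hCC, map_zero, sub_zero]
  set x := a j with hx
  -- Decompose along `W C + C W = 1`: a cocycle for `x ^ e` is determined by its two components.
  have key (e : ℕ) (y z) (h : D y + x ^ e • W y = z) :
      D (C (W y)) = C (W z) ∧ C z = x ^ e • C (W y) - D (C y) := by
    subst h
    simp only [map_add, map_smul, hWD, hCD, hWW, map_neg, smul_zero, neg_neg, add_zero]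
    exact ⟨trivial, by abel⟩
  intro z hz hdz
  obtain ⟨hu, hv⟩ := key _ z 0 hdz
  rw [map_zero, map_zero] at hu
  rw [map_zero, eq_comm, sub_eq_zero] at hv
  -- `x ^ m C W z + W C z` is a cocycle for `x`, with components those of `z`, one scaled by `x ^ m`.
  have hz₁ : x ^ m • C (W z) + W (C z) ∈ koszulFil M q (n + m) (Function.update k j 1) := by
    rw [mem_koszulFil] at hz ⊢
    intro J
    have e := hz J
    simp only [Pi.add_apply, Pi.smul_apply, hW, hC, contr_wedge_apply, wedge_contr_apply]
    by_cases hj : j ∈ J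
    · simp only [if_pos hj, smul_zero, zero_add]
      rw [sum_update_eq_add_erase k hj] at e ⊢
      convert e using 3
      ring
    · simp only [if_neg hj, add_zero]
      rw [Finset.sum_update_of_notMem hj] at e ⊢
      exact smul_mem_pow_add (Ideal.pow_mem_pow ha m) e (by ring)
  have hdz₁ : D (x ^ m • C (W z) + W (C z)) + x • W (x ^ m • C (W z) + W (C z)) = 0 := by
    have e : D (W (C z)) = - W (D (C z)) := by rw [hWD, neg_neg]
    simp only [map_add, map_smul, hu, e, ← hv, hWCW, hWW, smul_zero, add_zero, zero_add,
      smul_smul, ← pow_succ']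
    abel
  obtain ⟨w₁, hw₁, hdw₁⟩ := h1 _ hz₁ hdz₁
  obtain ⟨hu₁, hv₁⟩ := key 1 w₁ (x ^ m • C (W z) + W (C z)) (by rw [pow_one, hdw₁])
  simp only [map_add, map_smul, hWCW, hWW, hCC, smul_zero, add_zero, zero_add,
    hCWC, pow_one] at hu₁ hv₁
  -- The cochain `w₁` bounds `x ^ m C W z`, which turns `C W z` into a cocycle for `x ^ m`.
  have hz₂ : C (W z) + W w₁ ∈ koszulFil M q n (Function.update k j m) := by
    rw [mem_koszulFil] at hz hw₁ ⊢
    intro J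
    have e := hz J
    have e1 := hw₁ (J.erase j)
    simp only [Pi.add_apply, hW, hC, contr_wedge_apply, wedge_apply]
    by_cases hj : j ∈ J
    · simp only [if_pos hj, zero_add]
      refine Submodule.smul_mem _ _ ?_
      rw [Finset.sum_update_of_notMem (Finset.notMem_erase j J)] at e1
      rwa [sum_update_eq_add_erase k hj, ← add_assoc]
    · simp only [if_neg hj, add_zero]
      rw [Finset.sum_update_of_notMem hj] at e ⊢
      exact e
  have hdz₂ : D (C (W z) + W w₁) + x ^ m • W (C (W z) + W w₁) = 0 := by
    have e : D (W w₁) = - W (D w₁) := by rw [hWD, neg_neg]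
    have e' : D w₁ = x ^ m • C (W z) + W (C z) - x • W w₁ := by rw [← hdw₁]; abel
    simp only [map_add, e, e', map_sub, map_smul, hWW, hWCW, hu, smul_zero]
    module
  obtain ⟨w₂, hw₂, hdw₂⟩ := hm _ hz₂ hdz₂
  obtain ⟨hu₂, hv₂⟩ := key _ _ _ hdw₂
  simp only [map_add, hWCW, hWW, hCC, add_zero, zero_add] at hu₂ hv₂
  refine ⟨C (W w₂) + (x • W (C w₂) + W (C w₁)), ?_, ?_⟩
  · rw [mem_koszulFil] at hw₁ hw₂ ⊢
    intro J
    have e1 := hw₁ J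
    have e2 := hw₂ J
    simp only [Pi.add_apply, Pi.smul_apply, hW, hC, contr_wedge_apply, wedge_contr_apply]
    by_cases hj : j ∈ J
    · rw [sum_update_eq_add_erase k hj] at e1 e2 ⊢
      simp only [if_pos hj, zero_add]
      refine add_mem (smul_mem_pow_add (m := 1) (by simpa using ha) e2 (by ring)) ?_
      convert e1 using 3
      ring
    · simp only [if_neg hj, smul_zero, add_zero]
      rw [Finset.sum_update_of_notMem hj] at e2 ⊢
      exact e2
  · have e : D (W (C w₂)) = W (- D (C w₂)) := by rw [map_neg, hWD, neg_neg]
    have e' : D (W (C w₁)) = W (- D (C w₁)) := by rw [map_neg, hWD, neg_neg]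
    have e₂ : - D (C w₂) = C (W w₁) - x ^ m • C (W w₂) := by rw [hv₂]; abel
    have e₁ : - D (C w₁) = C z - x • C (W w₁) := by rw [hv₁]; abel
    simp only [map_add, map_smul, e, e', e₁, e₂, hWCW, hWW, map_sub, smul_zero, add_zero, hu₂,
      smul_sub, smul_smul, ← pow_succ']
    rw [hCW]
    abel

lemma koszulFiltration_stable (q : Ideal A) : (koszulFiltration M ι q).Stable := by
  -- it is even true that `q F_n = F_{n+1}` for all `n`
  refine ⟨0, fun n _ => le_antisymm ((koszulFiltration M ι q).smul_le n) fun z hz => ?_⟩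
  have hz' := mem_koszulFil.1 hz
  rw [← Finset.univ_sum_single z]
  refine Submodule.sum_mem _ fun J _ => ?_
  have h : q • (q ^ (n + ∑ j ∈ J, 1) • (⊤ : Submodule A M)) ≤
      (q • (koszulFiltration M ι q).N n).comap (LinearMap.single A (fun _ => M) J) := by
    refine Submodule.smul_le.2 fun r hr y hy => ?_
    rw [Submodule.mem_comap, map_smul]
    refine Submodule.smul_mem_smul hr (mem_koszulFil.2 fun K => ?_)
    by_cases hK : K = J
    · subst hK; simpa using hy
    · simp [hK]
  refine h ?_
  rw [← mul_smul, ← pow_succ']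
  convert hz' J using 3
  ring

/-- The Koszul cohomology of the Rees module on `a_1 T, …, a_t T` vanishes in large degrees, since it
is finitely generated and annihilated by every `a_j T`. -/
lemma exists_koszulExact_one [IsNoetherianRing A] [Module.Finite A M] (a : ι → A) :
    ∃ N, ∀ n, N ≤ n → KoszulExact s M (Ideal.span (Set.range a)) a n fun _ => 1 := by
  set q := Ideal.span (Set.range a) with hq
  set d : (Finset ι → M) →ₗ[A] (Finset ι → M) := koszulD s (fun j => a j ^ 1) with hd
  obtain ⟨N, hN⟩ := (koszulFiltration_stable (M := M) (ι := ι) q).inter_right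
    (F' := q.trivialFiltration (LinearMap.ker d))
  refine ⟨N + 1, fun n hn z hz hdz => ?_⟩
  obtain ⟨n, rfl⟩ : ∃ n', n = n' + 1 := ⟨n - 1, by omega⟩
  have hz' : z ∈ q • (koszulFil M q n (fun _ => 1) ⊓ LinearMap.ker d) := by
    have := hN n (by omega)
    refine this.ge ?_
    exact ⟨hz, hdz⟩
  have hle : q • (koszulFil M q n (fun _ => 1) ⊓ LinearMap.ker d) ≤
      (koszulFil M q (n + 1) (fun _ => 1)).map d := by
    refine Submodule.smul_le.2 fun r hr y hy => ?_
    induction hr using Submodule.span_induction with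
    | mem r hr =>
      obtain ⟨j, rfl⟩ := hr
      refine ⟨contr s j y, ?_, ?_⟩
      · refine mem_koszulFil.2 fun J => ?_
        rw [contr_apply]
        split_ifs with hj
        · exact zero_mem _
        · refine Submodule.smul_mem _ _ ?_
          have := mem_koszulFil.1 hy.1 (insert j J)
          rw [Finset.sum_insert hj] at this
          convert this using 3
          ring
      · have := contr_koszulD s (fun j => a j ^ 1) j y
        rw [← hd, LinearMap.mem_ker.1 hy.2, map_zero, pow_one, eq_comm, sub_eq_zero] at this
        exact this.symm
    | zero => simp
    | add r r' _ _ h h' => rw [add_smul]; exact add_mem h h'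
    | smul r r' _ h => rw [smul_assoc]; exact Submodule.smul_mem _ _ h
  obtain ⟨w, hw, rfl⟩ := hle hz'
  exact ⟨w, hw, rfl⟩

/-- Serre vanishing for the Koszul cohomology of the Rees module, uniformly in the exponents. -/
lemma exists_koszulExact [IsNoetherianRing A] [Module.Finite A M] (a : ι → A) :
    ∃ N, ∀ n, N ≤ n → ∀ k : ι → ℕ, (∀ j, 1 ≤ k j) →
      KoszulExact s M (Ideal.span (Set.range a)) a n k := by
  obtain ⟨N, hN⟩ := exists_koszulExact_one s (M := M) a
  refine ⟨N, fun n hn k hk => ?_⟩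
  induction hS : ∑ j, k j using Nat.strong_induction_on generalizing n k with
  | _ S ih =>
    by_cases h : ∀ j, k j = 1
    · obtain rfl : k = fun _ => 1 := funext h
      exact hN n hn
    · push Not at h
      obtain ⟨j, hj⟩ := h
      obtain ⟨m, hm, hkm⟩ : ∃ m, 1 ≤ m ∧ k j = m + 1 :=
        ⟨k j - 1, by have := hk j; omega, by have := hk j; omega⟩
      have hsum (e : ℕ) (he : 1 ≤ e) (he' : e ≤ m) (n' : ℕ) (hn' : N ≤ n') :
          KoszulExact s M (Ideal.span (Set.range a)) a n' (Function.update k j e) := by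
        refine ih _ ?_ n' hn' _ (fun i => ?_) rfl
        · rw [← hS, sum_update_eq_add_erase k (Finset.mem_univ j),
            ← Finset.add_sum_erase _ _ (Finset.mem_univ j)]
          omega
        · by_cases hi : i = j
          · subst hi; simpa using he
          · simpa [hi] using hk i
      have := KoszulExact.update_succ s (Ideal.subset_span (Set.mem_range_self j))
        (hsum 1 le_rfl hm (n + m) (by omega)) (hsum m hm le_rfl n hn)
      rwa [← hkm, Function.update_eq_self] at this

end Koszul

/-! ### Fractions with a common denominator -/

section Fractions

variable {A : Type u} [CommRing A] {M : Type u} [AddCommGroup M] [Module A M]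

variable (M) in
/-- The linear map `m ↦ m / f ^ k`. -/
def fracLin (f : A) (k : ℕ) : M →ₗ[A] Away f M where
  toFun m := frac f m k
  map_add' m m' := by
    unfold frac
    rw [LocalizedModule.mk_add_mk, ← smul_add, LocalizedModule.mk_cancel_common_left]
  map_smul' r m := by
    unfold frac
    exact (LocalizedModule.smul'_mk r m (⟨f ^ k, k, rfl⟩ : Submonoid.powers f)).symm

lemma frac_zero (f : A) (k : ℕ) : frac f (0 : M) k = 0 := map_zero (fracLin M f k)

lemma frac_smul (f : A) (r : A) (m : M) (k : ℕ) : frac f (r • m) k = r • frac f m k :=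
  map_smul (fracLin M f k) r m

lemma fracLin_apply (f : A) (k : ℕ) (m : M) : fracLin M f k m = frac f m k := rfl

lemma exists_eq_frac {f : A} (x : Away f M) : ∃ (k : ℕ) (m : M), x = frac f m k := by
  induction x using LocalizedModule.induction_on with
  | h m s =>
    obtain ⟨_, k, rfl⟩ := s
    exact ⟨k, m, rfl⟩

lemma frac_pow_smul (f : A) (m : M) (k l : ℕ) : frac f (f ^ l • m) (k + l) = frac f m k := by
  refine LocalizedModule.mk_eq.2 ⟨1, ?_⟩
  change (1 : A) • f ^ k • f ^ l • m = (1 : A) • f ^ (k + l) • m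
  rw [one_smul, one_smul, smul_smul, ← pow_add]

lemma frac_eq_zero {f : A} {m : M} {k : ℕ} (h : frac f m k = 0) : ∃ l, f ^ l • m = 0 := by
  obtain ⟨⟨_, l, rfl⟩, hl⟩ := LocalizedModule.mk_eq.1 (h.trans (frac_zero f k).symm)
  change f ^ l • f ^ k • m = f ^ l • f ^ k • (0 : M) at hl
  rw [smul_smul, ← pow_add, smul_zero, smul_zero] at hl
  exact ⟨l + k, hl⟩

/-- The submodule `q ^ n M[q ^ c / f]` consists of the fractions `m / f ^ k` with
`m ∈ q ^ (n + c k) M`. -/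
lemma mem_pow_smul_fracSubmodule {q : Ideal A} {c : ℕ} {f : A} (hf : f ∈ q ^ c) {n : ℕ}
    {x : Away f M} : x ∈ q ^ n • fracSubmodule M q c f ↔
      ∃ (k : ℕ) (m : M), m ∈ q ^ (n + c * k) • (⊤ : Submodule A M) ∧ x = frac f m k := by
  constructor
  · intro hx
    have hraise (n k l : ℕ) (m : M) (hm : m ∈ q ^ (n + c * k) • (⊤ : Submodule A M)) :
        f ^ l • m ∈ q ^ (n + c * (k + l)) • (⊤ : Submodule A M) :=
      smul_mem_pow_add (m := c * l) (by rw [pow_mul]; exact Ideal.pow_mem_pow hf l) hm (by ring)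
    have hadd (n : ℕ) (x y : Away f M)
        (hx : ∃ (k : ℕ) (m : M), m ∈ q ^ (n + c * k) • (⊤ : Submodule A M) ∧ x = frac f m k)
        (hy : ∃ (k : ℕ) (m : M), m ∈ q ^ (n + c * k) • (⊤ : Submodule A M) ∧ y = frac f m k) :
        ∃ (k : ℕ) (m : M), m ∈ q ^ (n + c * k) • (⊤ : Submodule A M) ∧ x + y = frac f m k := by
      obtain ⟨k, m, hm, rfl⟩ := hx
      obtain ⟨l, m', hm', rfl⟩ := hy
      refine ⟨k + l, f ^ l • m + f ^ k • m', add_mem (hraise n k l m hm) ?_, ?_⟩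
      · rw [add_comm k l]
        exact hraise n l k m' hm'
      · rw [← fracLin_apply f (k + l), map_add, fracLin_apply, fracLin_apply, frac_pow_smul,
          add_comm k l, frac_pow_smul]
    induction hx using Submodule.smul_induction_on' with
    | add x _ y _ hx hy => exact hadd n x y hx hy
    | smul r hr y hy =>
      have : ∃ (k : ℕ) (m : M), m ∈ q ^ (0 + c * k) • (⊤ : Submodule A M) ∧ y = frac f m k := by
        induction hy using Submodule.span_induction with
        | mem y hy =>
          obtain ⟨k, r, m, hr, rfl⟩ := hy
          exact ⟨k, r • m, Submodule.smul_mem_smul (by simpa using hr) trivial, rfl⟩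
        | zero => exact ⟨0, 0, zero_mem _, (frac_zero f 0).symm⟩
        | add x y _ _ hx hy => exact hadd 0 x y hx hy
        | smul r x _ hx =>
          obtain ⟨k, m, hm, rfl⟩ := hx
          exact ⟨k, r • m, Submodule.smul_mem _ _ hm, (frac_smul f r m k).symm⟩
      obtain ⟨k, m, hm, rfl⟩ := this
      exact ⟨k, r • m, smul_mem_pow_add hr hm (by ring), (frac_smul f r m k).symm⟩
  · rintro ⟨k, m, hm, rfl⟩
    have h : (q ^ (n + c * k) • (⊤ : Submodule A M)).map (fracLin M f k) ≤
        q ^ n • fracSubmodule M q c f := by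
      rw [pow_add, mul_smul, Submodule.map_smul'']
      refine Submodule.smul_mono le_rfl (Submodule.map_le_iff_le_comap.2 ?_)
      exact Submodule.smul_le.2 fun r hr y _ => Submodule.subset_span ⟨k, r, y, hr, rfl⟩
    exact h ⟨m, hm, rfl⟩

end Fractions

/-! ### Čech cochains as Koszul cochains -/

section Cochains

variable {A : Type u} [CommRing A] {t : ℕ} (a : Fin t → A)

variable (A t) in
/-- The signs of the Čech complex. -/
def cechSigns : KoszulSigns A (Fin t) where
  sgn J j := (-1) ^ pos J j
  mul_self J j := by rw [← mul_pow]; simp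
  swap hj hl h := by rw [← pow_add, ← pow_add]; exact sign_swap hj hl h

lemma prodOn_mem_pow {q : Ideal A} (ha : ∀ j, a j ∈ q) (J : Finset (Fin t)) :
    prodOn a J ∈ q ^ J.card := by
  have := Ideal.prod_mem_prod (s := J) (I := fun _ => q) (x := a) fun j _ => ha j
  rwa [Finset.prod_const] at this

variable {M : Type u} [AddCommGroup M] [Module A M]

lemma koszulD_prodOn_pow_smul (s : KoszulSigns A (Fin t)) (k l : ℕ) (m : Finset (Fin t) → M) :
    koszulD s (fun j => a j ^ (k + l)) (fun J => prodOn a J ^ l • m J) =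
      fun J => prodOn a J ^ l • koszulD s (fun j => a j ^ k) m J := by
  funext J
  rw [koszulD_apply, koszulD_apply, Finset.smul_sum]
  refine Finset.sum_congr rfl fun j _ => ?_
  rw [smul_smul, smul_smul, smul_smul, smul_smul]
  have h : prodOn a J = prodOn a (J.erase j) * a j := (Finset.prod_erase_mul _ _ j.2).symm
  rw [h]
  congr 1
  ring

/-- The Čech cochain with the components `m_J / a_J ^ k`. -/
def fracCochain (i : ℕ) (m : Finset (Fin t) → M) (k : ℕ) : CechX a M i :=
  fun J => frac (prodOn a J.1) (m J.1) k

lemma fracCochain_prodOn_pow_smul (i : ℕ) (m : Finset (Fin t) → M) (k l : ℕ) :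
    fracCochain a i (fun J => prodOn a J ^ l • m J) (k + l) = fracCochain a i m k :=
  funext fun _ => frac_pow_smul _ _ _ _

lemma cechD_fracCochain (i : ℕ) (m : Finset (Fin t) → M) (k : ℕ) :
    cechD a M i (fracCochain a i m k) =
      fracCochain a (i + 1) (koszulD (cechSigns A t) (fun j => a j ^ k) m) k := by
  funext J
  rw [cechD_apply]
  unfold fracCochain
  rw [koszulD_apply, ← fracLin_apply, map_sum]
  refine Finset.sum_congr rfl fun j _ => ?_
  rw [awayMap_frac _ (a j) M (prodOn_eq a J j), smul_comm, map_smul, fracLin_apply]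
  rfl

/-- Every Čech cocycle comes from a Koszul cocycle for the powers `a_j ^ k` with `k` large, where
a property `P` of numerators that is stable under passing to larger denominators can be retained. -/
lemma exists_koszul_cocycle {i : ℕ} (P : Idx t i → ℕ → M → Prop)
    (hP : ∀ J k l m, P J k m → P J (k + l) (prodOn a J.1 ^ l • m)) {x : CechX a M i}
    (hx : ∀ J, ∃ k m, P J k m ∧ x J = frac (prodOn a J.1) m k) (hdx : cechD a M i x = 0) :
    ∃ (k : ℕ) (m : Finset (Fin t) → M), 1 ≤ k ∧ (∀ J, J.card ≠ i → m J = 0) ∧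
      (∀ J : Idx t i, P J k (m J.1)) ∧ x = fracCochain a i m k ∧
      koszulD (cechSigns A t) (fun j => a j ^ k) m = 0 := by
  choose k₀ m₀ hP₀ hx₀ using hx
  let k := ∑ J, k₀ J + 1
  have hk (J) : k₀ J ≤ k :=
    (Finset.single_le_sum (fun _ _ => Nat.zero_le _) (Finset.mem_univ J)).trans (Nat.le_succ _)
  let m : Finset (Fin t) → M := fun J =>
    if h : J.card = i then prodOn a J ^ (k - k₀ ⟨J, h⟩) • m₀ ⟨J, h⟩ else 0
  have hm (J : Idx t i) : m J.1 = prodOn a J.1 ^ (k - k₀ J) • m₀ J := dif_pos J.2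
  have hm0 (J) (hJ : J.card ≠ i) : m J = 0 := dif_neg hJ
  have hPm (J : Idx t i) : P J k (m J.1) := by
    rw [hm]
    have := hP J (k₀ J) (k - k₀ J) (m₀ J) (hP₀ J)
    rwa [Nat.add_sub_cancel' (hk J)] at this
  have hxm : x = fracCochain a i m k := by
    funext J
    have := frac_pow_smul (prodOn a J.1) (m₀ J) (k₀ J) (k - k₀ J)
    rw [Nat.add_sub_cancel' (hk J)] at this
    rw [hx₀, fracCochain, hm, this]
  have hl (J : Finset (Fin t)) : ∃ l,
      prodOn a J ^ l • koszulD (cechSigns A t) (fun j => a j ^ k) m J = 0 := by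
    by_cases hJ : J.card = i + 1
    · rw [hxm, cechD_fracCochain] at hdx
      exact frac_eq_zero (congrFun hdx ⟨J, hJ⟩)
    · refine ⟨0, ?_⟩
      rw [koszulD_apply, Finset.sum_eq_zero, smul_zero]
      intro j _
      have h1 := Finset.card_erase_add_one j.2
      rw [hm0 _ (by omega), smul_zero, smul_zero]
  choose l hl using hl
  let L := ∑ J, l J
  refine ⟨k + L, fun J => prodOn a J ^ L • m J, by omega, fun J hJ => ?_, fun J => ?_, ?_, ?_⟩
  · change prodOn a J ^ L • m J = 0
    rw [hm0 J hJ, smul_zero]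
  · exact hP _ _ _ _ (hPm J)
  · rw [fracCochain_prodOn_pow_smul, hxm]
  · rw [koszulD_prodOn_pow_smul]
    funext J
    have hJ : l J ≤ L := Finset.single_le_sum (fun _ _ => Nat.zero_le _) (Finset.mem_univ J)
    rw [← Nat.sub_add_cancel hJ, pow_add, mul_smul, hl, smul_zero, Pi.zero_apply]

/-- For `n ≫ 0` the subcomplex `Č(a, a, M; n)` is exact. -/
theorem exists_subCechX_exact [IsNoetherianRing A] [Module.Finite A M] :
    ∃ N, ∀ n, N ≤ n →
      (∀ x ∈ subCechX a M (Ideal.span (Set.range a)) (fun _ => 1) n 0,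
        cechD a M 0 x = 0 → x = 0) ∧
      ∀ i, ∀ x ∈ subCechX a M (Ideal.span (Set.range a)) (fun _ => 1) n (i + 1),
        cechD a M (i + 1) x = 0 →
          ∃ y ∈ subCechX a M (Ideal.span (Set.range a)) (fun _ => 1) n i, cechD a M i y = x := by
  obtain ⟨N, hN⟩ := exists_koszulExact (cechSigns A t) (M := M) a
  set q := Ideal.span (Set.range a)
  have haq (j) : a j ∈ q := Ideal.subset_span ⟨j, rfl⟩
  have hmem (n : ℕ) {i : ℕ} (J : Idx t i) (y : Away (prodOn a J.1) M) :
      y ∈ q ^ n • fracSubmodule M q (∑ _j ∈ J.1, 1) (prodOn a J.1) ↔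
        ∃ (k : ℕ) (m : M), m ∈ q ^ (n + i * k) • (⊤ : Submodule A M) ∧
          y = frac (prodOn a J.1) m k := by
    rw [Finset.sum_const, smul_eq_mul, mul_one, mem_pow_smul_fracSubmodule (prodOn_mem_pow a haq _),
      J.2]
  have key (n : ℕ) (hn : N ≤ n) (i : ℕ) (x) (hx : x ∈ subCechX a M q (fun _ => 1) n i)
      (hdx : cechD a M i x = 0) : ∃ (k : ℕ) (w : Finset (Fin t) → M),
        w ∈ koszulFil M q n (fun _ => k) ∧
        x = fracCochain a i (koszulD (cechSigns A t) (fun j => a j ^ k) w) k := by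
    obtain ⟨k, m, hk, hm0, hm, rfl, hdm⟩ := exists_koszul_cocycle a
      (fun J k m => m ∈ q ^ (n + i * k) • (⊤ : Submodule A M))
      (fun J k l m h => smul_mem_pow_add (m := i * l)
        (by simpa only [pow_mul, J.2] using Ideal.pow_mem_pow (prodOn_mem_pow a haq J.1) l) h (by ring))
      (fun J => (hmem n J _).1 (Submodule.mem_pi.1 hx J (Set.mem_univ _))) hdx
    obtain ⟨w, hw, hdw⟩ := hN n hn (fun _ => k) (fun _ => hk) m (mem_koszulFil.2 fun J => by
      by_cases hJ : J.card = i
      · rw [Finset.sum_const, hJ]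
        exact hm ⟨J, hJ⟩
      · rw [hm0 J hJ]
        exact zero_mem _) hdm
    exact ⟨k, w, hw, by rw [hdw]⟩
  refine ⟨N, fun n hn => ⟨fun x hx hdx => ?_, fun i x hx hdx => ?_⟩⟩
  · obtain ⟨k, w, -, rfl⟩ := key n hn 0 x hx hdx
    funext J
    obtain ⟨J, hJ⟩ := J
    obtain rfl := Finset.card_eq_zero.1 hJ
    unfold fracCochain
    rw [koszulD_apply, Finset.univ_eq_empty, Finset.sum_empty]
    exact frac_zero _ k
  · obtain ⟨k, w, hw, rfl⟩ := key n hn (i + 1) x hx hdx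
    refine ⟨fracCochain a i w k, Submodule.mem_pi.2 fun J _ => (hmem n J _).2 ⟨k, w J.1, ?_, rfl⟩,
      cechD_fracCochain a i w k⟩
    have := mem_koszulFil.1 hw J.1
    rwa [Finset.sum_const, J.2] at this

end Cochains

/-! ### The Čech complex of an injective module -/

section Injective

variable {A : Type u} [CommRing A] {t : ℕ}

variable (A t) in
/-- The signs of the homological Koszul complex, transposed to the signs of the Čech complex; a
subset stands for the coordinate at its complement, so that the differential raises degrees. -/
def dualSigns : KoszulSigns A (Fin t) where
  sgn J j := (-1) ^ pos Jᶜ j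
  mul_self J j := by rw [← mul_pow]; simp
  swap {J j l} hj hl h := by
    have e (S : Finset (Fin t)) (i : Fin t) : pos (insert i S) i = pos S i := by
      unfold pos
      rw [Finset.filter_insert, if_neg (lt_irrefl i)]
    have h1 : (insert j (insert l Jᶜ)).erase j = insert l Jᶜ :=
      Finset.erase_insert (by simp [h, hj])
    have h2 : (insert j (insert l Jᶜ)).erase l = insert j Jᶜ := by
      rw [Finset.insert_comm]
      exact Finset.erase_insert (by simp [h.symm, hl])
    have := sign_swap (A := A) (J := insert j (insert l Jᶜ)) (j := j) (l := l) (by simp) (by simp) h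
    rw [h1, h2, e, e, e, Finset.insert_comm, e] at this
    rw [Finset.compl_erase, Finset.compl_erase, ← pow_add, ← pow_add, add_comm ((-1) ^ _),
      add_comm (pos Jᶜ l), add_comm (pos Jᶜ j)]
    exact this

variable {M : Type u} [AddCommGroup M] [Module A M]

/-- The pairing of Koszul chains (indexed by complements) and Koszul cochains. -/
def pairing (m : Finset (Fin t) → M) : (Finset (Fin t) → A) →ₗ[A] M :=
  ∑ J, (LinearMap.proj Jᶜ : (Finset (Fin t) → A) →ₗ[A] A).smulRight (m J)

lemma pairing_apply (m : Finset (Fin t) → M) (z : Finset (Fin t) → A) :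
    pairing m z = ∑ J, z Jᶜ • m J := by
  simp [pairing]

lemma pairing_single (m : Finset (Fin t) → M) (J : Finset (Fin t)) :
    pairing m (Pi.single Jᶜ (1 : A)) = m J := by
  rw [pairing_apply, Finset.sum_eq_single J]
  · simp
  · intro K _ hK
    rw [Pi.single_eq_of_ne (fun h => hK (compl_injective h)), zero_smul]
  · simp

/-- The differentials of the two Koszul complexes are adjoint. -/
lemma pairing_koszulD (c : Fin t → A) (m : Finset (Fin t) → M) (z : Finset (Fin t) → A) :
    pairing m (koszulD (dualSigns A t) c z) = pairing (koszulD (cechSigns A t) c m) z := by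
  have key (j : Fin t) :
      pairing m (wedge (dualSigns A t) j z) = pairing (wedge (cechSigns A t) j m) z := by
    rw [pairing_apply, pairing_apply]
    simp only [wedge_apply, ite_smul, zero_smul, smul_ite, smul_zero]
    rw [← Finset.sum_filter, ← Finset.sum_filter]
    refine Finset.sum_nbij' (fun J => insert j J) (fun J => J.erase j) ?_ ?_ ?_ ?_ ?_
    · intro J _
      simp
    · intro J _
      simp
    · intro J hJ
      exact Finset.erase_insert (by simpa using hJ)
    · intro J hJ
      exact Finset.insert_erase (by simpa using hJ)
    · intro J hJ
      have hj : j ∉ J := by simpa using hJ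
      have e : pos (insert j J) j = pos J j := by
        unfold pos
        rw [Finset.filter_insert, if_neg (lt_irrefl j)]
      change ((-1 : A) ^ pos Jᶜᶜ j • z (Jᶜ.erase j)) • m J =
        z (insert j J)ᶜ • (-1 : A) ^ pos (insert j J) j • m ((insert j J).erase j)
      rw [compl_compl, e, Finset.erase_insert hj, Finset.compl_insert, smul_smul, smul_eq_mul,
        mul_comm]
  rw [koszulD_eq_sum, koszulD_eq_sum, map_sum, pairing_apply]
  simp only [Finset.sum_apply, Pi.smul_apply, Finset.smul_sum]
  rw [Finset.sum_comm]
  refine Finset.sum_congr rfl fun j _ => ?_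
  rw [map_smul, key, pairing_apply, Finset.smul_sum]
  exact Finset.sum_congr rfl fun J _ => smul_comm _ _ _

/-- Truncation to the subsets with `i` elements commutes with the Koszul differential up to a
shift of degrees. -/
lemma koszulD_truncate (s : KoszulSigns A (Fin t)) (c : Fin t → A) (i : ℕ)
    (z : Finset (Fin t) → M) (hz : koszulD s c z = 0) :
    koszulD s c (fun J => if J.card = i then z J else 0) = 0 := by
  funext J
  rw [koszulD_apply]
  by_cases hJ : J.card = i + 1
  · have := congrFun hz J
    rw [koszulD_apply] at this
    rw [← this]
    refine Finset.sum_congr rfl fun j _ => ?_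
    rw [if_pos]
    have := Finset.card_erase_add_one j.2
    omega
  · refine Finset.sum_eq_zero fun j _ => ?_
    rw [if_neg, smul_zero, smul_zero]
    have := Finset.card_erase_add_one j.2
    omega

/-- The Čech complex of an injective module over a Noetherian ring is exact in positive degrees. A
Koszul cocycle `m` for the exponent `k` is a linear form on Koszul chains. Its image for an exponent
`l ≫ k` vanishes on cycles, since these become boundaries for the exponent `k`; so it factors
through the differential, and it is a coboundary by injectivity. -/
theorem cech_exact_of_injective [IsNoetherianRing A] [Module.Injective A M] (a : Fin t → A)
    (i : ℕ) (x : CechX a M (i + 1)) (hx : cechD a M (i + 1) x = 0) :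
    ∃ y, cechD a M i y = x := by
  rcases lt_or_ge t (i + 1) with hi | hi
  · refine ⟨0, funext fun J => ?_⟩
    have := J.1.card_le_univ
    rw [J.2, Fintype.card_fin] at this
    omega
  obtain ⟨k, m, hk, hm0, -, rfl, hdm⟩ := exists_koszul_cocycle a (fun _ _ _ => True)
    (fun _ _ _ _ _ => trivial)
    (fun J => let ⟨k, m, h⟩ := exists_eq_frac (x J); ⟨k, m, trivial, h⟩) hx
  obtain ⟨N, hN⟩ := exists_koszulExact (dualSigns A t) (M := A) a
  set q := Ideal.span (Set.range a)
  have haq (j) : a j ∈ q := Ideal.subset_span ⟨j, rfl⟩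
  -- large enough for `a_J ^ l`, with `J` nonempty, to reach the filtration step `N`
  let l := N + k * t
  set d := koszulD (M := A) (dualSigns A t) (fun j => a j ^ (k + l)) with hd
  let m' : Finset (Fin t) → M := fun J => prodOn a J ^ l • m J
  have hker : LinearMap.ker d ≤ LinearMap.ker (pairing m') := by
    intro z hz
    have hz' := koszulD_truncate _ _ (t - (i + 1)) z hz
    -- `y` is the image of the truncation of `z` in the Koszul complex for the exponent `k`
    let y : Finset (Fin t) → A := fun J =>
      prodOn a Jᶜ ^ l • if J.card = t - (i + 1) then z J else 0
    have hy : y ∈ koszulFil A q N (fun _ => k) := by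
      refine mem_koszulFil.2 fun J => ?_
      by_cases hJ : J.card = t - (i + 1)
      · refine smul_mem_pow_add (l := 0) (m := N + ∑ _j ∈ J, k) ?_ (by simp) rfl
        have hc : Jᶜ.card = i + 1 := by
          rw [Finset.card_compl, Fintype.card_fin]
          omega
        have h1 := Ideal.pow_mem_pow (prodOn_mem_pow a haq Jᶜ) l
        rw [← pow_mul, hc] at h1
        refine Ideal.pow_le_pow_right ?_ h1
        rw [Finset.sum_const, smul_eq_mul, mul_comm _ k]
        have : k * J.card ≤ k * t := Nat.mul_le_mul_left k (by omega)
        calc N + k * J.card ≤ l := by omega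
          _ ≤ (i + 1) * l := Nat.le_mul_of_pos_left l (by omega)
      · simp [y, hJ]
    have hdy : koszulD (dualSigns A t) (fun j => a j ^ k) y = 0 := by
      funext J
      have h := congrFun hz' J
      rw [koszulD_apply] at h ⊢
      rw [Pi.zero_apply, ← smul_zero (prodOn a Jᶜ ^ l), ← Pi.zero_apply (M := fun _ => A) J, ← h,
        Finset.smul_sum]
      refine Finset.sum_congr rfl fun j _ => ?_
      have hj : (j : Fin t) ∉ Jᶜ := by simp
      have e : prodOn a (J.erase j)ᶜ = a j * prodOn a Jᶜ := by
        rw [Finset.compl_erase, prodOn, Finset.prod_insert hj]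
      simp only [y, e, smul_eq_mul]
      ring
    obtain ⟨v, -, hv⟩ := hN N le_rfl (fun _ => k) (fun _ => hk) y hy hdy
    have e : pairing m' z = pairing m y := by
      rw [pairing_apply, pairing_apply]
      refine Finset.sum_congr rfl fun J _ => ?_
      by_cases hJ : J.card = i + 1
      · have : Jᶜ.card = t - (i + 1) := by rw [Finset.card_compl, Fintype.card_fin, hJ]
        simp only [m', y, compl_compl, if_pos this, smul_smul, smul_eq_mul]
        rw [mul_comm]
      · simp only [m', hm0 J hJ, smul_zero]
    rw [LinearMap.mem_ker, e, ← hv, pairing_koszulD, hdm, pairing_apply]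
    simp
  obtain ⟨ψ, hψ⟩ := Module.Injective.out ((LinearMap.ker d).liftQ d le_rfl)
    (LinearMap.ker_eq_bot.1 (Submodule.ker_liftQ_eq_bot _ _ _ le_rfl))
    ((LinearMap.ker d).liftQ (pairing m') hker)
  have hψ' (z) : ψ (d z) = pairing m' z := hψ (Submodule.Quotient.mk z)
  let w : Finset (Fin t) → M := fun J => ψ (Pi.single Jᶜ 1)
  have hw : ψ = pairing w := by
    refine LinearMap.pi_ext' fun J => LinearMap.ext_ring ?_
    have := pairing_single (A := A) w Jᶜ
    rw [compl_compl] at this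
    change ψ (Pi.single J 1) = pairing w (Pi.single J 1)
    rw [this]
    simp [w]
  have hdw : koszulD (cechSigns A t) (fun j => a j ^ (k + l)) w = m' := by
    funext J
    rw [← pairing_single (A := A) m' J, ← hψ', hw, hd, pairing_koszulD, pairing_single]
  refine ⟨fracCochain a i w (k + l), ?_⟩
  rw [cechD_fracCochain, hdw, fracCochain_prodOn_pow_smul]

end Injective

/-! ### Subquotients -/

section Subquotient

variable {A : Type u} [CommRing A]

/-- The subquotient `Z / (Z ∩ B)`: the cohomology when `Z` are the cocycles and `B` the coboundaries.
-/
abbrev Coh {X : Type u} [AddCommGroup X] [Module A X] (Z B : Submodule A X) : Type u :=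
  Z ⧸ B.submoduleOf Z

variable {X Y : Type u} [AddCommGroup X] [Module A X] [AddCommGroup Y] [Module A Y]

/-- A linear relation between the cocycles on both sides that is total in both directions and
matches coboundaries with coboundaries induces an isomorphism in cohomology. -/
lemma nonempty_coh_equiv {Z B : Submodule A X} {Z' B' : Submodule A Y} (R : Submodule A (X × Y))
    (h₁ : ∀ z ∈ Z, ∃ z' ∈ Z', (z, z') ∈ R) (h₂ : ∀ z' ∈ Z', ∃ z ∈ Z, (z, z') ∈ R)
    (h₃ : ∀ z ∈ Z, ∀ z' ∈ Z', (z, z') ∈ R → (z ∈ B ↔ z' ∈ B')) :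
    Nonempty (Coh Z B ≃ₗ[A] Coh Z' B') := by
  let W : Submodule A (X × Y) := R ⊓ Z.prod Z'
  let f : W →ₗ[A] Z := (LinearMap.fst A X Y ∘ₗ W.subtype).codRestrict Z fun w => w.2.2.1
  let g : W →ₗ[A] Z' := (LinearMap.snd A X Y ∘ₗ W.subtype).codRestrict Z' fun w => w.2.2.2
  let F := (B.submoduleOf Z).mkQ ∘ₗ f
  let G := (B'.submoduleOf Z').mkQ ∘ₗ g
  have hF : Function.Surjective F := by
    refine (Submodule.mkQ_surjective _).comp fun z => ?_
    obtain ⟨z', hz', h⟩ := h₁ z.1 z.2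
    exact ⟨⟨(z.1, z'), h, z.2, hz'⟩, rfl⟩
  have hG : Function.Surjective G := by
    refine (Submodule.mkQ_surjective _).comp fun z' => ?_
    obtain ⟨z, hz, h⟩ := h₂ z'.1 z'.2
    exact ⟨⟨(z, z'.1), h, hz, z'.2⟩, rfl⟩
  have hFG : LinearMap.ker F = LinearMap.ker G := by
    ext w
    rw [LinearMap.mem_ker, LinearMap.mem_ker]
    change (B.submoduleOf Z).mkQ (f w) = 0 ↔ (B'.submoduleOf Z').mkQ (g w) = 0
    rw [Submodule.mkQ_apply, Submodule.mkQ_apply, Submodule.Quotient.mk_eq_zero,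
      Submodule.Quotient.mk_eq_zero]
    exact h₃ w.1.1 w.2.2.1 w.1.2 w.2.2.2 w.2.1
  exact ⟨(F.quotKerEquivOfSurjective hF).symm ≪≫ₗ Submodule.quotEquivOfEq _ _ hFG ≪≫ₗ
    G.quotKerEquivOfSurjective hG⟩

/-- The homology of a complex of modules as a subquotient. -/
lemma nonempty_homology_iso (K : CochainComplex (ModuleCat.{u} A) ℕ) (i j k : ℕ)
    (hi : (ComplexShape.up ℕ).prev j = i) (hk : (ComplexShape.up ℕ).next j = k) :
    Nonempty (K.homology j ≅
      ModuleCat.of A (Coh (LinearMap.ker (K.d j k).hom) (LinearMap.range (K.d i j).hom))) := by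
  have e : LinearMap.range (K.sc' i j k).moduleCatToCycles =
      (LinearMap.range (K.d i j).hom).submoduleOf (LinearMap.ker (K.d j k).hom) := by
    ext x
    constructor
    · rintro ⟨y, rfl⟩
      exact ⟨y, rfl⟩
    · rintro ⟨y, hy⟩
      exact ⟨y, Subtype.ext hy⟩
  exact ⟨ShortComplex.homologyMapIso (K.isoSc' i j k hi hk) ≪≫
    (K.sc' i j k).moduleCatHomologyIso ≪≫ (Submodule.quotEquivOfEq _ _ e).toModuleIso⟩

lemma nonempty_homology_iso_zero (K : CochainComplex (ModuleCat.{u} A) ℕ) :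
    Nonempty (K.homology 0 ≅
      ModuleCat.of A (Coh (LinearMap.ker (K.d 0 1).hom) (⊥ : Submodule A (K.X 0)))) := by
  have := nonempty_homology_iso K 0 0 1 (by simp) (by simp)
  rwa [K.shape 0 0 (by simp), ModuleCat.hom_zero, LinearMap.range_zero] at this

lemma nonempty_homology_iso_succ (K : CochainComplex (ModuleCat.{u} A) ℕ) (i : ℕ) :
    Nonempty (K.homology (i + 1) ≅ ModuleCat.of A
      (Coh (LinearMap.ker (K.d (i + 1) (i + 2)).hom) (LinearMap.range (K.d i (i + 1)).hom))) :=
  nonempty_homology_iso K i (i + 1) (i + 2) (by simp) (by simp)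

end Subquotient

/-! ### Functoriality of the Čech complex -/

section CechMap

variable {A : Type u} [CommRing A] {t : ℕ} (a : Fin t → A)
variable {X Y Z : Type u} [AddCommGroup X] [Module A X] [AddCommGroup Y] [Module A Y]
  [AddCommGroup Z] [Module A Z]

/-- The localization `X_f → Y_f` of a linear map. -/
def awayHom (f : A) (φ : X →ₗ[A] Y) : Away f X →ₗ[A] Away f Y :=
  IsLocalizedModule.map (Submonoid.powers f) (LocalizedModule.mkLinearMap (Submonoid.powers f) X)
    (LocalizedModule.mkLinearMap (Submonoid.powers f) Y) φ

lemma awayHom_frac (f : A) (φ : X →ₗ[A] Y) (x : X) (k : ℕ) :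
    awayHom f φ (frac f x k) = frac f (φ x) k := by
  have h := IsLocalizedModule.map_mk' (Submonoid.powers f)
    (LocalizedModule.mkLinearMap (Submonoid.powers f) X)
    (LocalizedModule.mkLinearMap (Submonoid.powers f) Y) φ x ⟨f ^ k, Submonoid.pow_mem _
      (Submonoid.mem_powers f) k⟩
  rwa [← IsLocalizedModule.mk_eq_mk', ← IsLocalizedModule.mk_eq_mk'] at h

lemma awayMap_awayHom {f g : A} (h : f ∣ g) (φ : X →ₗ[A] Y) (x : Away f X) :
    awayMap h Y (awayHom f φ x) = awayHom g φ (awayMap h X x) := by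
  obtain ⟨k, x, rfl⟩ := exists_eq_frac x
  obtain ⟨b, rfl⟩ := h
  rw [awayHom_frac, awayMap_frac f b Y rfl, awayMap_frac f b X rfl, awayHom_frac, map_smul]

/-- The map of Čech complexes induced by a linear map. -/
def cechMap (φ : X →ₗ[A] Y) (i : ℕ) : CechX a X i →ₗ[A] CechX a Y i :=
  LinearMap.pi fun J => awayHom (prodOn a J.1) φ ∘ₗ LinearMap.proj J

lemma cechMap_apply (φ : X →ₗ[A] Y) (i : ℕ) (x : CechX a X i) (J : Idx t i) :
    cechMap a φ i x J = awayHom (prodOn a J.1) φ (x J) := rfl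

lemma cechD_cechMap (φ : X →ₗ[A] Y) (i : ℕ) (x : CechX a X i) :
    cechD a Y i (cechMap a φ i x) = cechMap a φ (i + 1) (cechD a X i x) := by
  funext J
  rw [cechMap_apply, cechD_apply, cechD_apply, map_sum]
  refine Finset.sum_congr rfl fun j _ => ?_
  rw [map_smul, ← awayMap_awayHom, cechMap_apply]

lemma cechMap_injective {φ : X →ₗ[A] Y} (hφ : Function.Injective φ) (i : ℕ) :
    Function.Injective (cechMap a φ i) := fun _ _ h => funext fun J =>
  IsLocalizedModule.map_injective _ _ _ φ hφ (congrFun h J)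

lemma cechMap_surjective {φ : X →ₗ[A] Y} (hφ : Function.Surjective φ) (i : ℕ) :
    Function.Surjective (cechMap a φ i) := fun y => by
  have hJ (J : Idx t i) : Function.Surjective (awayHom (prodOn a J.1) φ) := fun z => by
    obtain ⟨k, z, rfl⟩ := exists_eq_frac z
    obtain ⟨x, rfl⟩ := hφ z
    exact ⟨frac _ x k, awayHom_frac _ _ _ _⟩
  choose x hx using fun J => hJ J (y J)
  exact ⟨x, funext hx⟩

lemma cechMap_exact {φ : X →ₗ[A] Y} {ψ : Y →ₗ[A] Z} (h : Function.Exact φ ψ) (i : ℕ) :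
    Function.Exact (cechMap a φ i) (cechMap a ψ i) := fun y => by
  have hJ (J : Idx t i) : Function.Exact (awayHom (prodOn a J.1) φ) (awayHom (prodOn a J.1) ψ) :=
    IsLocalizedModule.map_exact (Submonoid.powers (prodOn a J.1))
    (LocalizedModule.mkLinearMap (.powers (prodOn a J.1)) X)
    (LocalizedModule.mkLinearMap (.powers (prodOn a J.1)) Y)
    (LocalizedModule.mkLinearMap (.powers (prodOn a J.1)) Z) φ ψ h
  constructor
  · intro hy
    choose x hx using fun J => (hJ J (y J)).1 (by rw [← cechMap_apply, hy]; rfl)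
    exact ⟨x, funext hx⟩
  · rintro ⟨x, rfl⟩
    exact funext fun J => (hJ J _).2 ⟨x J, rfl⟩

variable (X) in
/-- The identification of `X` with the term `X_1` of degree zero of the Čech complex. -/
def cechZero : X →ₗ[A] CechX a X 0 :=
  LinearMap.pi fun J => fracLin X (prodOn a J.1) 0

lemma cechZero_apply (x : X) : cechZero a X x = fracCochain a 0 (fun _ => x) 0 := rfl

lemma cechMap_cechZero (φ : X →ₗ[A] Y) (x : X) :
    cechMap a φ 0 (cechZero a X x) = cechZero a Y (φ x) :=
  funext fun _ => awayHom_frac _ _ _ _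

lemma cechZero_injective : Function.Injective (cechZero a X) := by
  rw [injective_iff_map_eq_zero]
  intro x hx
  have h := congrFun hx (⟨∅, rfl⟩ : Idx t 0)
  obtain ⟨l, hl⟩ := frac_eq_zero (f := prodOn a ∅) h
  rwa [prodOn, Finset.prod_empty, one_pow, one_smul] at hl

lemma cechZero_surjective : Function.Surjective (cechZero a X) := by
  intro y
  obtain ⟨k, x, hx⟩ := exists_eq_frac (y (⟨∅, rfl⟩ : Idx t 0))
  refine ⟨x, funext fun J => ?_⟩
  obtain rfl : J = ⟨∅, rfl⟩ := Subtype.ext (Finset.card_eq_zero.1 J.2)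
  rw [hx]
  have h := frac_pow_smul (prodOn a ∅) x 0 k
  have h1 : prodOn a ∅ ^ k • x = x := by rw [prodOn, Finset.prod_empty, one_pow, one_smul]
  rw [h1, zero_add] at h
  exact h.symm

lemma mem_sections_iff {x : X} :
    x ∈ sections (Ideal.span (Set.range a)) X ↔ ∀ j, ∃ k : ℕ, a j ^ k • x = 0 := by
  refine (support_span_le_iff _ x).trans ⟨fun h j => ?_, fun h p hp => ?_⟩
  · have hj : a j ∈ (Ideal.torsionOf A X x).radical := by
      rw [Ideal.radical_eq_sInf, Ideal.mem_sInf]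
      rintro p ⟨hp, hp'⟩
      exact h ⟨p, hp'⟩ (fun r hr => hp hr) (Ideal.subset_span ⟨j, rfl⟩)
    exact hj
  · rw [Ideal.span_le]
    rintro _ ⟨j, rfl⟩
    obtain ⟨k, hk⟩ := h j
    exact p.2.mem_of_pow_mem k (hp _ hk)

/-- In degree zero, the Čech complex computes the sections with support. -/
lemma cechD_cechZero_eq_zero {x : X} :
    cechD a X 0 (cechZero a X x) = 0 ↔ x ∈ sections (Ideal.span (Set.range a)) X := by
  have h1 (j : Fin t) : koszulD (cechSigns A t) (fun j => a j ^ 0) (fun _ => x) {j} =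
      (-1 : A) ^ pos {j} j • x := by
    rw [koszulD_apply, Fintype.sum_eq_single ⟨j, Finset.mem_singleton_self j⟩, pow_zero, one_smul]
    · rfl
    · rintro ⟨l, hl⟩ h
      exact absurd (Subtype.ext (Finset.mem_singleton.1 hl)) h
  rw [mem_sections_iff, cechZero_apply, cechD_fracCochain]
  constructor
  · intro h j
    have hj := congrFun h ⟨{j}, Finset.card_singleton j⟩
    obtain ⟨l, hl⟩ := frac_eq_zero (f := prodOn a {j}) hj
    refine ⟨l, ?_⟩
    change prodOn a {j} ^ l • koszulD (cechSigns A t) (fun j => a j ^ 0) (fun _ => x) {j} = 0 at hl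
    rw [h1, prodOn, Finset.prod_singleton, smul_comm] at hl
    have := congrArg (fun y => (-1 : A) ^ pos {j} j • y) hl
    simpa only [smul_smul, ← mul_assoc, ← mul_pow, neg_mul_neg, one_mul, one_pow, smul_zero]
      using this
  · intro h
    funext ⟨J, hJ⟩
    obtain ⟨j, rfl⟩ := Finset.card_eq_one.1 hJ
    obtain ⟨k, hk⟩ := h j
    change frac (prodOn a {j})
      (koszulD (cechSigns A t) (fun j => a j ^ 0) (fun _ => x) {j}) 0 = 0
    have hk' : prodOn a {j} ^ k • x = 0 := by rwa [prodOn, Finset.prod_singleton]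
    rw [h1, ← frac_pow_smul _ _ 0 k, smul_comm, hk', smul_zero, frac_zero]

end CechMap

/-! ### Local cohomology and Čech cohomology -/

section Comparison

variable {A : Type u} [CommRing A] {t : ℕ} (a : Fin t → A)

/-- The coboundaries of the Čech complex. -/
def cechB (M : Type u) [AddCommGroup M] [Module A M] : ∀ i, Submodule A (CechX a M i)
  | 0 => ⊥
  | i + 1 => LinearMap.range (cechD a M i)

/-- The cocycles in degree `i` of the complex of sections of a sequence of modules. -/
def secZ (q : Ideal A) (I : ℕ → ModuleCat.{u} A) (d : ∀ n, I n →ₗ[A] I (n + 1)) (i : ℕ) :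
    Submodule A (I i) :=
  sections q (I i) ⊓ LinearMap.ker (d i)

/-- The coboundaries in degree `i` of the complex of sections of a sequence of modules. -/
def secB (q : Ideal A) (I : ℕ → ModuleCat.{u} A) (d : ∀ n, I n →ₗ[A] I (n + 1)) :
    ∀ i, Submodule A (I i)
  | 0 => ⊥
  | i + 1 => (sections q (I i)).map (d i)

/-- Dimension shifting: if `0 → X → I → Y → 0` is exact and the Čech complex of `I` is exact in
positive degrees, then the Čech cohomology of `Y` is that of `X` one degree higher. -/
lemma nonempty_cech_shift {X I Y : Type u} [AddCommGroup X] [Module A X] [AddCommGroup I]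
    [Module A I] [AddCommGroup Y] [Module A Y] {f : X →ₗ[A] I} {g : I →ₗ[A] Y}
    (hf : Function.Injective f) (hfg : Function.Exact f g) (hg : Function.Surjective g)
    (hI : ∀ i x, cechD a I (i + 1) x = 0 → ∃ y, cechD a I i y = x) (i : ℕ) :
    Nonempty (Coh (LinearMap.ker (cechD a X (i + 2))) (cechB a X (i + 2)) ≃ₗ[A]
      Coh (LinearMap.ker (cechD a Y (i + 1))) (cechB a Y (i + 1))) := by
  have hgf (n : ℕ) (x) : cechMap a g n (cechMap a f n x) = 0 := (cechMap_exact a hfg n _).2 ⟨x, rfl⟩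
  -- the relation between `x` and `y` whose graph is that of the connecting homomorphism up to
  -- coboundaries
  refine nonempty_coh_equiv
    { carrier := {w | ∃ z, cechMap a g (i + 1) z = w.2 ∧ cechD a I (i + 1) z =
        cechMap a f (i + 2) w.1}
      zero_mem' := ⟨0, by simp⟩
      add_mem' := by
        rintro _ _ ⟨z, h1, h2⟩ ⟨z', h1', h2'⟩
        exact ⟨z + z', by simp [h1, h1'], by simp [h2, h2']⟩
      smul_mem' := by
        rintro c _ ⟨z, h1, h2⟩
        exact ⟨c • z, by simp [h1], by simp [h2]⟩ } ?_ ?_ ?_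
  · intro x hx
    obtain ⟨z, hz⟩ := hI (i + 1) (cechMap a f (i + 2) x)
      (by rw [cechD_cechMap, LinearMap.mem_ker.1 hx, map_zero])
    exact ⟨_, by rw [LinearMap.mem_ker, cechD_cechMap, hz, hgf], z, rfl, hz⟩
  · intro y hy
    obtain ⟨z, rfl⟩ := cechMap_surjective a hg (i + 1) y
    rw [LinearMap.mem_ker, cechD_cechMap] at hy
    obtain ⟨x, hx⟩ := (cechMap_exact a hfg (i + 2) _).1 hy
    refine ⟨x, cechMap_injective a hf _ ?_, z, rfl, hx.symm⟩
    rw [← cechD_cechMap, hx, cechD_cechD, map_zero]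
  · rintro x hx y hy ⟨z, hz, hzx⟩
    change cechMap a g (i + 1) z = y at hz
    change _ = cechMap a f (i + 2) x at hzx
    subst hz
    constructor
    · rintro ⟨w, rfl⟩
      obtain ⟨v, hv⟩ := hI i (z - cechMap a f (i + 1) w)
        (by rw [map_sub, hzx, cechD_cechMap, sub_self])
      exact ⟨cechMap a g i v, by rw [cechD_cechMap, hv, map_sub, hgf, sub_zero]⟩
    · rintro ⟨w, hw⟩
      obtain ⟨v, rfl⟩ := cechMap_surjective a hg i w
      obtain ⟨x', hx'⟩ := (cechMap_exact a hfg (i + 1) (z - cechD a I i v)).1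
        (by rw [map_sub, ← cechD_cechMap, hw, sub_self])
      refine ⟨x', cechMap_injective a hf _ ?_⟩
      rw [← cechD_cechMap, hx', map_sub, cechD_cechD, sub_zero, hzx]

/-- The Čech cohomology of a module is the cohomology of the sections of an injective resolution. -/
theorem nonempty_cech_equiv_sections [IsNoetherianRing A] (i : ℕ) :
    ∀ (X : Type u) [AddCommGroup X] [Module A X] (I : ℕ → ModuleCat.{u} A)
      (_ : ∀ n, Module.Injective A (I n)) (d : ∀ n, I n →ₗ[A] I (n + 1)) (f : X →ₗ[A] I 0)
      (_ : Function.Injective f) (_ : Function.Exact f (d 0))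
      (_ : ∀ n, Function.Exact (d n) (d (n + 1))),
      Nonempty (Coh (LinearMap.ker (cechD a X i)) (cechB a X i) ≃ₗ[A]
        Coh (secZ (Ideal.span (Set.range a)) I d i) (secB (Ideal.span (Set.range a)) I d i)) := by
  induction i using Nat.strong_induction_on with
  | _ i ih =>
  intro X _ _ I hI d f hf hfd hd
  have hdf (x) : d 0 (f x) = 0 := (hfd _).2 ⟨x, rfl⟩
  match i with
  | 0 =>
    refine nonempty_coh_equiv
      { carrier := {w | ∃ x, cechZero a X x = w.1 ∧ f x = w.2}
        zero_mem' := ⟨0, by simp⟩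
        add_mem' := by
          rintro _ _ ⟨x, h1, h2⟩ ⟨x', h1', h2'⟩
          exact ⟨x + x', by simp [h1, h1'], by simp [h2, h2']⟩
        smul_mem' := by
          rintro c _ ⟨x, h1, h2⟩
          exact ⟨c • x, by simp [h1], by simp [h2]⟩ } ?_ ?_ ?_
    · intro y hy
      obtain ⟨x, rfl⟩ := cechZero_surjective a y
      exact ⟨f x, ⟨sections_le_comap _ f ((cechD_cechZero_eq_zero a).1 hy), hdf x⟩, x, rfl, rfl⟩
    · rintro u ⟨hu, hdu⟩
      obtain ⟨x, rfl⟩ := (hfd u).1 hdu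
      refine ⟨cechZero a X x, cechMap_injective a hf _ ?_, x, rfl, rfl⟩
      rw [← cechD_cechMap, cechMap_cechZero, (cechD_cechZero_eq_zero a).2 hu, map_zero]
    · rintro _ - _ - ⟨x, rfl, rfl⟩
      change cechZero a X x = 0 ↔ f x = 0
      rw [map_eq_zero_iff _ (cechZero_injective a), map_eq_zero_iff _ hf]
  | 1 =>
    refine nonempty_coh_equiv
      { carrier := {w | ∃ v, cechD a (I 0) 0 (cechZero a (I 0) v) = cechMap a f 1 w.1 ∧
          d 0 v = w.2}
        zero_mem' := ⟨0, by simp⟩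
        add_mem' := by
          rintro _ _ ⟨x, h1, h2⟩ ⟨x', h1', h2'⟩
          exact ⟨x + x', by simp [h1, h1'], by simp [h2, h2']⟩
        smul_mem' := by
          rintro c _ ⟨x, h1, h2⟩
          exact ⟨c • x, by simp [h1], by simp [h2]⟩ } ?_ ?_ ?_
    · intro x hx
      have := hI 0
      obtain ⟨y, hy⟩ := cech_exact_of_injective a 0 (cechMap a f 1 x)
        (by rw [cechD_cechMap, LinearMap.mem_ker.1 hx, map_zero])
      obtain ⟨v, rfl⟩ := cechZero_surjective a y
      refine ⟨d 0 v, ⟨?_, (hd 0 _).2 ⟨v, rfl⟩⟩, v, hy, rfl⟩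
      refine (cechD_cechZero_eq_zero a).1 ?_
      rw [← cechMap_cechZero, cechD_cechMap, hy]
      exact (cechMap_exact a hfd 1 _).2 ⟨x, rfl⟩
    · rintro u ⟨hu, hdu⟩
      obtain ⟨v, rfl⟩ := (hd 0 u).1 hdu
      obtain ⟨x, hx⟩ := (cechMap_exact a hfd 1 (cechD a (I 0) 0 (cechZero a (I 0) v))).1
        (by rw [← cechD_cechMap, cechMap_cechZero, (cechD_cechZero_eq_zero a).2 hu])
      refine ⟨x, cechMap_injective a hf _ ?_, v, hx.symm, rfl⟩
      rw [← cechD_cechMap, hx, cechD_cechD, map_zero]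
    · rintro x - _ - ⟨v, hv, rfl⟩
      change _ = cechMap a f 1 x at hv
      constructor
      · rintro ⟨y, rfl⟩
        obtain ⟨w, rfl⟩ := cechZero_surjective a y
        refine ⟨v - f w, (cechD_cechZero_eq_zero a).1 ?_, ?_⟩
        · rw [map_sub, map_sub, hv, ← cechMap_cechZero, cechD_cechMap, sub_self]
        · rw [map_sub, hdf, sub_zero]
      · rintro ⟨v', hv', hvv'⟩
        obtain ⟨w, hw⟩ := (hfd (v - v')).1 (by rw [map_sub, hvv', sub_self])
        refine ⟨cechZero a X w, cechMap_injective a hf _ ?_⟩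
        rw [← cechD_cechMap, cechMap_cechZero, hw, map_sub, map_sub,
          (cechD_cechZero_eq_zero a).2 hv', sub_zero, hv]
  | i + 2 =>
    have := hI 0
    let g : I 0 →ₗ[A] LinearMap.ker (d 1) := (d 0).codRestrict _ fun v => (hd 0 _).2 ⟨v, rfl⟩
    have hfg : Function.Exact f g := fun v => by
      rw [← hfd v, ← Subtype.coe_inj]
      rfl
    have hg : Function.Surjective g := fun ⟨u, hu⟩ => by
      obtain ⟨v, rfl⟩ := (hd 0 u).1 hu
      exact ⟨v, rfl⟩
    obtain ⟨e⟩ := nonempty_cech_shift a hf hfg hg (cech_exact_of_injective a) i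
    obtain ⟨e'⟩ := ih (i + 1) (by omega) (LinearMap.ker (d 1)) (fun n => I (n + 1))
      (fun n => hI (n + 1)) (fun n => d (n + 1)) (LinearMap.ker (d 1)).subtype
      Subtype.val_injective (fun u => ⟨fun h => ⟨⟨u, h⟩, rfl⟩, fun ⟨v, hv⟩ => hv ▸ v.2⟩)
      (fun n => hd (n + 1))
    exact ⟨e ≪≫ₗ e'⟩

/-- The homology of the complex of sections of a complex of modules. -/
lemma nonempty_homology_sections_iso (q : Ideal A) (K : CochainComplex (ModuleCat.{u} A) ℕ)
    (i : ℕ) :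
    Nonempty ((((sectionFunctor q).mapHomologicalComplex _).obj K).homology i ≅
      ModuleCat.of A (Coh (secZ q K.X (fun n => (K.d n (n + 1)).hom) i)
        (secB q K.X (fun n => (K.d n (n + 1)).hom) i))) := by
  let G := ((sectionFunctor q).mapHomologicalComplex (ComplexShape.up ℕ)).obj K
  have hZ (n : ℕ) (u : sections q (K.X n)) : u ∈ LinearMap.ker (G.d n (n + 1)).hom ↔
      (K.d n (n + 1)).hom u.1 = 0 := Subtype.ext_iff
  have key (n : ℕ) (B : Submodule A (G.X n)) (B' : Submodule A (K.X n))
      (hB : ∀ u : sections q (K.X n), u ∈ B ↔ u.1 ∈ B') :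
      Nonempty (Coh (LinearMap.ker (G.d n (n + 1)).hom) B ≃ₗ[A]
        Coh (secZ q K.X (fun n => (K.d n (n + 1)).hom) n) B') :=
    nonempty_coh_equiv (LinearMap.graph (sections q (K.X n)).subtype)
      (fun u hu => ⟨u.1, ⟨u.2, (hZ n u).1 hu⟩, rfl⟩)
      (fun u hu => ⟨⟨u, hu.1⟩, (hZ n ⟨u, hu.1⟩).2 hu.2, rfl⟩)
      (fun u _ v _ h => by rw [show v = u.1 from h]; exact hB u)
  match i with
  | 0 =>
    obtain ⟨e⟩ := nonempty_homology_iso_zero G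
    obtain ⟨e'⟩ := key 0 ⊥ ⊥ fun u => Subtype.ext_iff
    exact ⟨e ≪≫ e'.toModuleIso⟩
  | i + 1 =>
    obtain ⟨e⟩ := nonempty_homology_iso_succ G i
    obtain ⟨e'⟩ := key (i + 1) (LinearMap.range (G.d i (i + 1)).hom)
      ((sections q (K.X i)).map (K.d i (i + 1)).hom) fun u =>
        ⟨fun ⟨v, hv⟩ => ⟨v.1, v.2, congrArg Subtype.val hv⟩,
          fun ⟨v, hv, hvu⟩ => ⟨⟨v, hv⟩, Subtype.ext hvu⟩⟩
    exact ⟨e ≪≫ e'.toModuleIso⟩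

/-- Over a Noetherian ring, local cohomology is Čech cohomology. -/
theorem nonempty_localCohomology_iso_cech [IsNoetherianRing A] (M : Type u) [AddCommGroup M]
    [Module A M] (i : ℕ) :
    Nonempty (H (Ideal.span (Set.range a)) M i ≅
      ModuleCat.of A (Coh (LinearMap.ker (cechD a M i)) (cechB a M i))) := by
  let P := injectiveResolution (ModuleCat.of A M)
  let I : ℕ → ModuleCat.{u} A := P.cocomplex.X
  let d : ∀ n, I n →ₗ[A] I (n + 1) := fun n => (P.cocomplex.d n (n + 1)).hom
  let f : M →ₗ[A] I 0 := (P.ι.f 0).hom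
  have hI (n) : Module.Injective A (I n) :=
    Module.injective_module_of_injective_object A (I n) (inj := P.injective n)
  have hf : Function.Injective f := (ModuleCat.mono_iff_injective (P.ι.f 0)).1 inferInstance
  have hfd : Function.Exact f (d 0) :=
    (ShortComplex.ShortExact.moduleCat_exact_iff_function_exact _).1 P.exact₀
  have hd (n) : Function.Exact (d n) (d (n + 1)) :=
    (ShortComplex.ShortExact.moduleCat_exact_iff_function_exact _).1 (P.exact_succ n)
  obtain ⟨e⟩ := nonempty_cech_equiv_sections a i M I hI d f hf hfd hd
  obtain ⟨e'⟩ := nonempty_homology_sections_iso (Ideal.span (Set.range a)) P.cocomplex i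
  exact ⟨P.isoRightDerivedObj _ i ≪≫ e' ≪≫ e.symm.toModuleIso⟩

end Comparison

/-! ### The factor complex -/

section Factor

variable {A : Type u} [CommRing A] {t : ℕ} (a : Fin t → A)
variable (M : Type u) [AddCommGroup M] [Module A M] (q : Ideal A) (c : Fin t → ℕ)

/-- If the subcomplex `Č(a, q, M; n)` is exact, then the factor complex has the cohomology of the
Čech complex. -/
lemma nonempty_L_iso_cech (ha : ∀ j, a j ∈ q ^ c j) (n : ℕ)
    (h₀ : ∀ x ∈ subCechX a M q c n 0, cechD a M 0 x = 0 → x = 0)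
    (h₁ : ∀ i, ∀ x ∈ subCechX a M q c n (i + 1), cechD a M (i + 1) x = 0 →
      ∃ y ∈ subCechX a M q c n i, cechD a M i y = x) (i : ℕ) :
    Nonempty (L a M q c ha n i ≅
      ModuleCat.of A (Coh (LinearMap.ker (cechD a M i)) (cechB a M i))) := by
  let S := subCechX a M q c n
  let D (i : ℕ) : (CechX a M i ⧸ S i) →ₗ[A] (CechX a M (i + 1) ⧸ S (i + 1)) :=
    Submodule.mapQ _ _ (cechD a M i) (subCechX_le_comap a M q c ha n i)
  have hD (i : ℕ) : ((factorComplex a M q c ha n).d i (i + 1)).hom = D i :=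
    congrArg ModuleCat.Hom.hom (CochainComplex.of_d
      (fun i => ModuleCat.of A (CechX a M i ⧸ S i)) (fun i => ModuleCat.ofHom (D i)) i)
  have key (i : ℕ) (B : Submodule A (CechX a M i ⧸ S i))
      (hB : ∀ x, cechD a M i x = 0 → ((S i).mkQ x ∈ B ↔ x ∈ cechB a M i)) :
      Nonempty (Coh (LinearMap.ker (D i)) B ≃ₗ[A]
        Coh (LinearMap.ker (cechD a M i)) (cechB a M i)) := by
    refine nonempty_coh_equiv ((LinearMap.graph (S i).mkQ).comap
      (LinearMap.prod (LinearMap.snd _ _ _) (LinearMap.fst _ _ _))) ?_ ?_ ?_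
    · intro z hz
      obtain ⟨x, rfl⟩ := (S i).mkQ_surjective z
      have hx : cechD a M i x ∈ S (i + 1) := (Submodule.Quotient.mk_eq_zero _).1 hz
      obtain ⟨y, hy, hyx⟩ := h₁ i _ hx (cechD_cechD a M i x)
      refine ⟨x - y, by rw [LinearMap.mem_ker, map_sub, hyx, sub_self], ?_⟩
      change (S i).mkQ x = (S i).mkQ (x - y)
      rw [map_sub, Submodule.mkQ_apply _ y, (Submodule.Quotient.mk_eq_zero _).2 hy, sub_zero]
    · intro x hx
      refine ⟨(S i).mkQ x, ?_, rfl⟩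
      change (S (i + 1)).mkQ (cechD a M i x) = 0
      rw [LinearMap.mem_ker.1 hx, map_zero]
    · intro z _ x hx h
      rw [show z = (S i).mkQ x from h]
      exact hB x hx
  match i with
  | 0 =>
    obtain ⟨e⟩ := nonempty_homology_iso_zero (factorComplex a M q c ha n)
    rw [hD 0] at e
    obtain ⟨e'⟩ := key 0 ⊥ fun x hx => by
      refine ⟨fun h => h₀ x ((Submodule.Quotient.mk_eq_zero _).1 h) hx, fun h => ?_⟩
      rw [show x = 0 from h, map_zero]
      exact zero_mem _
    exact ⟨e ≪≫ e'.toModuleIso⟩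
  | i + 1 =>
    obtain ⟨e⟩ := nonempty_homology_iso_succ (factorComplex a M q c ha n) i
    rw [hD i, hD (i + 1)] at e
    obtain ⟨e'⟩ := key (i + 1) (LinearMap.range (D i)) fun x hx => by
      constructor
      · rintro ⟨z, hz⟩
        obtain ⟨y, rfl⟩ := (S i).mkQ_surjective z
        have hxy : cechD a M i y - x ∈ S (i + 1) := (Submodule.Quotient.eq _).1 hz
        obtain ⟨w, -, hw⟩ := h₁ i _ hxy (by rw [map_sub, cechD_cechD, hx, sub_self])
        exact ⟨y - w, by rw [map_sub, hw, sub_sub_cancel]⟩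
      · rintro ⟨y, rfl⟩
        exact ⟨(S i).mkQ y, rfl⟩
    exact ⟨e ≪≫ e'.toModuleIso⟩

end Factor

end ModCech

end

theorem corollary1p2 {A : Type u} [CommRing A] [IsNoetherianRing A]
    {t : ℕ} (a : Fin t → A) (M : Type u) [AddCommGroup M] [Module A M] [Module.Finite A M] :
    ∃ N : ℕ, ∀ n : ℕ, N ≤ n → ∀ i : ℕ,
      Nonempty (ModCech.H (Ideal.span (Set.range a)) M i ≅
        ModCech.L a M (Ideal.span (Set.range a)) (fun _ => 1)
          (ModCech.mem_span_range_pow_one a) n i) := by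
  obtain ⟨N, hN⟩ := ModCech.exists_subCechX_exact a (M := M)
  refine ⟨N, fun n hn i => ?_⟩
  obtain ⟨e⟩ := ModCech.nonempty_localCohomology_iso_cech a M i
  obtain ⟨e'⟩ := ModCech.nonempty_L_iso_cech a M _ _ (ModCech.mem_span_range_pow_one a) n
    (hN n hn).1 (hN n hn).2 i
  exact ⟨e ≪≫ e'.symm⟩
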